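/- Let $(e_t)_{t\in\mathbb Z}$ be independent (not necessarily identically distributed) random variables with $E e_t=0$ and $\operatorname{Var}(e_t)=\sigma^2>0$, and let $(x_t)_{t\in\mathbb Z}$ be a (second-order) stationary process satisfying $$x_t+\sum_{i=1}^{\infty}a_i x_{t-i}=e_t,\qquad t\in\mathbb Z,$$ almost surely, with real coefficients $a_i$ such that $\sum_{i=1}^{\infty}|i^{1/2}a_i|<\infty$ and $A(z)=1+a_1z+a_2z^2+\cdots\neq0$ for all complex $|z|\le1$. Assume that $\sup_{t\in\mathbb Z}E|e_t|^{2q}<\infty$ for some real $q\ge2$, and let $(K_n)$ be a sequence of nonnegative integers with $K_n=O(n^{1/2})$. For $k\ge1$ put $\mathbf x_j(k)=(x_j,\dots,x_{j-k+1})'$ and $R(k)=E(\mathbf x_j(k)\mathbf x_j(k)')$ (which does not depend on $j$), put $N=n-K_n$, and write $\|\mathbf y\|_A^2=\mathbf y'A\mathbf y$. Then there is a constant $C$, independent of $n$ and $k$, such that for every $n$ with $K_n<n$ (hence for all sufficiently large $n$) and every $1\le k\le K_n$, the matrix $R(k)$ is invertible, the expectation below is finite, and $$k^{-q/2}\,E\left|\,\left\|\frac1{\sqrt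 N}\sum_{j=K_n}^{n-1}\mathbf x_j(k)e_{j+1}\right\|_{R^{-1}(k)}^2-k\sigma^2\right|^q\le C .$$ That is, $\max_{1\le k\le K_n}k^{-q/2}E\big|\cdots\big|^q\le C$. -/

import Mathlib

open MeasureTheory ProbabilityTheory Filter Asymptotics

noncomputable section

/-- Independent noise `(e_t)_{t ∈ ℤ}` with mean `0` and variance `σ²`
(not necessarily identically distributed). -/
structure IsNoise {Ω : Type*} [MeasurableSpace Ω] (μ : Measure Ω) (e : ℤ → Ω → ℝ) (σ : ℝ) :
    Prop where
  measurable : ∀ t, Measurable (e t)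
  memLp : ∀ t, MemLp (e t) 2 μ
  indep : iIndepFun e μ
  mean : ∀ t, ∫ ω, e t ω ∂μ = 0
  var : ∀ t, variance (e t) μ = σ ^ 2

/-- Second-order (weak) stationarity of a process indexed by `ℤ`. -/
structure IsWeaklyStationary {Ω : Type*} [MeasurableSpace Ω] (μ : Measure Ω) (x : ℤ → Ω → ℝ) :
    Prop where
  measurable : ∀ t, Measurable (x t)
  memLp : ∀ t, MemLp (x t) 2 μ
  mean : ∀ s t, ∫ ω, x s ω ∂μ = ∫ ω, x t ω ∂μ
  cov : ∀ s t h, covariance (x (s + h)) (x s) μ = covariance (x (t + h)) (x t) μ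

/-- The autoregression `x_t + ∑_{i ≥ 1} a_i x_{t-i} = e_t` for all `t ∈ ℤ`, where the series
converges almost surely. The coefficient sequence is `a 1, a 2, …`; the value `a 0` is not used. -/
def SatisfiesAR {Ω : Type*} [MeasurableSpace Ω] (μ : Measure Ω) (a : ℕ → ℝ)
    (x e : ℤ → Ω → ℝ) : Prop :=
  ∀ t : ℤ, ∀ᵐ ω ∂μ,
    HasSum (fun i : ℕ => a (i + 1) * x (t - ((i : ℤ) + 1)) ω) (e t ω - x t ω)

/-- `A(z) = 1 + a_1 z + a_2 z² + ⋯`. -/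
def arSeries (a : ℕ → ℝ) (z : ℂ) : ℂ :=
  1 + ∑' i : ℕ, (a (i + 1) : ℂ) * z ^ (i + 1)

/-- A weakly stationary AR(∞) process driven by `e` with `A(z) ≠ 0` for `|z| ≤ 1` and
`∑_{i ≥ 1} |i^{1/2} a_i| < ∞`. -/
structure IsARProcess {Ω : Type*} [MeasurableSpace Ω] (μ : Measure Ω) (a : ℕ → ℝ)
    (x e : ℤ → Ω → ℝ) : Prop where
  stationary : IsWeaklyStationary μ x
  ar : SatisfiesAR μ a x e
  ne_zero : ∀ z : ℂ, ‖z‖ ≤ 1 → arSeries a z ≠ 0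
  summable : Summable (fun i : ℕ => |((i : ℝ) + 1) ^ (1 / 2 : ℝ) * a (i + 1)|)

/-- `𝐱_t(k) = (x_t, x_{t-1}, …, x_{t-k+1})'`. -/
def lagVec {Ω : Type*} (x : ℤ → Ω → ℝ) (t : ℤ) (k : ℕ) (ω : Ω) : Fin k → ℝ :=
  fun i => x (t - (i : ℕ)) ω

/-- `R(k) = E(𝐱_t(k) 𝐱_t(k)')`; by stationarity it is the same matrix for every time `t`. -/
def covMatrix {Ω : Type*} [MeasurableSpace Ω] (μ : Measure Ω) (x : ℤ → Ω → ℝ) (t : ℤ) (k : ℕ) :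
    Matrix (Fin k) (Fin k) ℝ :=
  Matrix.of fun i j => ∫ ω, lagVec x t k ω i * lagVec x t k ω j ∂μ

/-- `‖y‖²_A = y' A y`. -/
def quadForm {k : ℕ} (A : Matrix (Fin k) (Fin k) ℝ) (y : Fin k → ℝ) : ℝ :=
  dotProduct y (A.mulVec y)

/-- `N^{-1/2} ∑_{j=m}^{n-1} 𝐱_j(k) e_{j+1}` with `N = n - m` (used for `m < n`). -/
def normalizedScore {Ω : Type*} (x e : ℤ → Ω → ℝ) (m n k : ℕ) (ω : Ω) : Fin k → ℝ :=
  (1 / Real.sqrt ((n : ℝ) - (m : ℝ))) •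
    ∑ j ∈ Finset.Ico m n, e ((j : ℤ) + 1) ω • lagVec x (j : ℤ) k ω

end

/-! Factor `R⁻¹ = Tᵀ * T` with `T * R * Tᵀ = 1`. The quadratic form becomes `N⁻¹ |S|²`, where `S = ∑
e_{j+1} g_j` and `g_j = T x_j(k)` is the whitened lag vector. A weighted Wiener lemma
(`exists_inverse_of_weighted_summable`) inverts the autoregression into `x_t = ∑ b_m e_{t-m}` with
`∑ √(m+1) |b_m| < ∞`. After deleting the noise before time `-M`, `g_t` is a finite sum `∑_{i<t} e_i
c_{t,i}` with deterministic vectors, and `S` is a martingale transform.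

Expanding the square (`sum_sq_recursion`) gives, with `s = σ²`, `|S_n|² - s ∑ |g_t|² = 2 ∑ e_t (S_t
· g_t) + ∑ (e_t² - s) |g_t|²`. Both sums on the right are martingales, controlled by the type 2
inequality `IsInnovation.lpNorm_sum_sq_le`. The target is a bound of order `N √k` in `L^q`, so `‖S_t
· g_t‖_q²` must be of order `N k`, whereas Cauchy–Schwarz alone gives `N k²`. The factor `k` is
recovered in `lpNorm_cross_sq_le` by cutting at time `t - 2k`. The last `2k` terms of `S_t` cost
only `k³ = O(N k)`. The earlier part of `S_t` against the recent part of `g_t` is again a martingale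
transform. The remote part of `g_t` has mass bounded independently of `k`, because `∑ (m+1) b_m² <
∞`.

The remaining fluctuation `∑ (|g_t|² - E|g_t|²)` consists of `N` centred quadratic forms, each
`O(√k)` by the same expansion and a Bessel inequality (`lpNorm_quadratic_le`). All constants are
uniform in `M`. As `M → ∞` the centring tends to `σ² N k`, since `T * R * Tᵀ` has trace `k`, and
Fatou's lemma finishes the proof. -/

/-! ### Wiener's lemma with weights. -/

/-- A submultiplicative weight on `ℕ`, normalised at `0`, of subexponential growth. -/
structure IsSubexpWeight (w : ℕ → ℝ) : Prop where
  zero : w 0 = 1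
  pos : ∀ i, 0 < w i
  submul : ∀ i n, w (i + n) ≤ w i * w n
  growth : ∀ r : ℝ, (∀ n, r ^ n ≤ w n) → r ≤ 1

lemma isSubexpWeight_sqrt : IsSubexpWeight (fun i : ℕ => √((i : ℝ) + 1)) where
  zero := by simp
  pos i := by positivity
  submul i n := by
    rw [← Real.sqrt_mul (by positivity)]
    apply Real.sqrt_le_sqrt
    push_cast
    nlinarith [mul_nonneg (Nat.cast_nonneg (α := ℝ) i) (Nat.cast_nonneg (α := ℝ) n)]
  growth r h := by
    by_contra! hr
    obtain ⟨n, hn⟩ := exists_nat_gt (1 / (r - 1) ^ 2)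
    have h0 : 0 < r - 1 := by linarith
    have h1 : 1 < n * (r - 1) ^ 2 := by rwa [div_lt_iff₀ (by positivity)] at hn
    have h2 : 1 + n * (r - 1) ≤ r ^ n := by
      have := one_add_mul_le_pow (a := r - 1) (by linarith) n
      simpa using this
    have h3 := (h2.trans (h n))
    have h4 := Real.le_sqrt' (by nlinarith [Nat.cast_nonneg (α := ℝ) n]) |>.1 h3
    rcases Nat.eq_zero_or_pos n with rfl | hpos
    · norm_num at h1
    · have : (1 : ℝ) ≤ n := by exact_mod_cast hpos
      nlinarith [mul_pos (by linarith : (0 : ℝ) < n) h0]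

section WeightedShift

variable {w : ℕ → ℝ}

/-- The `n`-th power of the weighted shift, as a map on sequences. -/
noncomputable def shiftSeq (w : ℕ → ℝ) (n : ℕ) (f : ℕ → ℂ) (i : ℕ) : ℂ :=
  if n ≤ i then ((w i / w (i - n) : ℝ) : ℂ) * f (i - n) else 0

lemma shiftSeq_add_right (n : ℕ) (f : ℕ → ℂ) (i : ℕ) :
    shiftSeq w n f (i + n) = ((w (i + n) / w i : ℝ) : ℂ) * f i := by
  simp [shiftSeq]

lemma hasSum_norm_shiftSeq_iff (n : ℕ) (f : ℕ → ℂ) (a : ℝ) :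
    HasSum (fun i => ‖((w (i + n) / w i : ℝ) : ℂ) * f i‖) a ↔
      HasSum (fun i => ‖shiftSeq w n f i‖) a := by
  rw [← (add_left_injective n).hasSum_iff (f := fun i => ‖shiftSeq w n f i‖)]
  · simp only [Function.comp_def, shiftSeq_add_right]
  · intro i hi
    have : ¬ n ≤ i := fun h => hi ⟨i - n, by simp [h]⟩
    simp [shiftSeq, this]

lemma norm_shiftSeq_term_le (hw : IsSubexpWeight w) (n : ℕ) (f : ℕ → ℂ) (i : ℕ) :
    ‖((w (i + n) / w i : ℝ) : ℂ) * f i‖ ≤ w n * ‖f i‖ := by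
  rw [norm_mul, Complex.norm_real, Real.norm_of_nonneg (div_pos (hw.pos _) (hw.pos _)).le]
  gcongr
  rw [div_le_iff₀ (hw.pos _), mul_comm]
  exact hw.submul i n

lemma summable_norm_lp_one (f : lp (fun _ : ℕ => ℂ) 1) : Summable fun i => ‖f i‖ := by
  simpa using (lp.memℓp f).summable (by simp)

lemma norm_lp_one (f : lp (fun _ : ℕ => ℂ) 1) : ‖f‖ = ∑' i, ‖f i‖ := by
  simpa using lp.norm_eq_tsum_rpow (p := 1) (by simp) f

lemma summable_norm_shiftSeq (hw : IsSubexpWeight w) (n : ℕ) (f : lp (fun _ : ℕ => ℂ) 1) :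
    Summable fun i => ‖shiftSeq w n f i‖ := by
  have h : Summable (fun i => ‖((w (i + n) / w i : ℝ) : ℂ) * f i‖) :=
    Summable.of_nonneg_of_le (fun _ => norm_nonneg _) (norm_shiftSeq_term_le hw n f)
      ((summable_norm_lp_one f).mul_left _)
  exact ((hasSum_norm_shiftSeq_iff n f _).1 h.hasSum).summable

lemma tsum_norm_shiftSeq_le (hw : IsSubexpWeight w) (n : ℕ) (f : lp (fun _ : ℕ => ℂ) 1) :
    ∑' i, ‖shiftSeq w n f i‖ ≤ w n * ‖f‖ := by
  have h : Summable (fun i => ‖((w (i + n) / w i : ℝ) : ℂ) * f i‖) :=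
    Summable.of_nonneg_of_le (fun _ => norm_nonneg _) (norm_shiftSeq_term_le hw n f)
      ((summable_norm_lp_one f).mul_left _)
  rw [((hasSum_norm_shiftSeq_iff n f _).1 h.hasSum).tsum_eq, norm_lp_one, ← tsum_mul_left]
  exact h.tsum_le_tsum (norm_shiftSeq_term_le hw n f) ((summable_norm_lp_one f).mul_left _)

/-- The `n`-th power of the weighted shift on `ℓ¹`. -/
noncomputable def weightedShift (hw : IsSubexpWeight w) (n : ℕ) :
    lp (fun _ : ℕ => ℂ) 1 →L[ℂ] lp (fun _ : ℕ => ℂ) 1 :=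
  LinearMap.mkContinuous
    { toFun := fun f => ⟨shiftSeq w n f, memℓp_gen (by
        simpa using summable_norm_shiftSeq hw n f)⟩
      map_add' := fun f g => by
        ext i
        change shiftSeq w n (f + g) i = shiftSeq w n f i + shiftSeq w n g i
        by_cases h : n ≤ i <;> simp [shiftSeq, h, mul_add]
      map_smul' := fun c f => by
        ext i
        change shiftSeq w n (c • f) i = c * shiftSeq w n f i
        by_cases h : n ≤ i <;> simp [shiftSeq, h, mul_left_comm] }
    (w n) (fun f => by
      rw [norm_lp_one]
      exact tsum_norm_shiftSeq_le hw n f)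

lemma weightedShift_apply (hw : IsSubexpWeight w) (n : ℕ) (f : lp (fun _ : ℕ => ℂ) 1) (i : ℕ) :
    weightedShift hw n f i = shiftSeq w n f i := rfl

lemma norm_weightedShift_le (hw : IsSubexpWeight w) (n : ℕ) : ‖weightedShift hw n‖ ≤ w n :=
  LinearMap.mkContinuous_norm_le _ (hw.pos n).le _

lemma weightedShift_eq_pow (hw : IsSubexpWeight w) (n : ℕ) :
    weightedShift hw n = weightedShift hw 1 ^ n := by
  induction n with
  | zero =>
    ext f i
    rw [weightedShift_apply]
    simp [shiftSeq, (hw.pos i).ne']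
  | succ n ih =>
    rw [pow_succ', ← ih]
    ext f i
    change shiftSeq w (n + 1) f i = shiftSeq w 1 (shiftSeq w n f) i
    simp only [shiftSeq]
    rcases Nat.lt_or_ge i (n + 1) with h | h
    · rw [if_neg (by omega)]
      split_ifs <;> first | rfl | omega | simp
    · rw [if_pos h, if_pos (by omega), if_pos (by omega), ← mul_assoc, ← Complex.ofReal_mul,
        div_mul_div_cancel₀ (hw.pos _).ne', Nat.sub_sub, add_comm 1 n]

/-- Gelfand theory: a non-unit is killed by some character `φ`. Since `|φ s|ⁿ ≤ ‖sⁿ‖ ≤ w n` and `w`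
is subexponential, `φ s` lies in the closed unit disc, where the power series does not vanish. -/
lemma isUnit_tsum_smul_pow {A : Type*} [NormedCommRing A] [NormedAlgebra ℂ A] [CompleteSpace A]
    [NormOneClass A] (hw : IsSubexpWeight w) (s : A) (hs : ∀ n, ‖s ^ n‖ ≤ w n) (a : ℕ → ℂ)
    (ha : Summable fun n => w n * ‖a n‖) (hne : ∀ z : ℂ, ‖z‖ ≤ 1 → ∑' n, a n * z ^ n ≠ 0) :
    ∃ u : A, HasSum (fun n => a n • s ^ n) u ∧ IsUnit u := by
  have hsum : Summable fun n => a n • s ^ n := by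
    refine Summable.of_norm_bounded ha fun n => ?_
    rw [norm_smul, mul_comm]
    gcongr
    exact hs n
  refine ⟨_, hsum.hasSum, ?_⟩
  by_contra hnu
  obtain ⟨φ, hφ⟩ := WeakDual.CharacterSpace.exists_apply_eq_zero hnu
  have h1 : ‖φ s‖ ≤ 1 := by
    refine hw.growth _ fun n => ?_
    rw [← norm_pow, ← map_pow]
    exact (spectrum.norm_le_norm_of_mem (AlgHom.apply_mem_spectrum φ (s ^ n))).trans (hs n)
  refine hne _ h1 ?_
  have h2 : HasSum (fun n => φ (a n • s ^ n)) (φ (∑' n, a n • s ^ n)) :=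
    hsum.hasSum.map φ (map_continuous φ)
  rw [hφ] at h2
  simpa using h2.tsum_eq

/-- The closed subalgebra generated by `s` is commutative, so the commutative case applies inside
it. -/
lemma exists_mul_eq_one_tsum_smul_pow {E : Type*} [NormedRing E] [NormedAlgebra ℂ E]
    [CompleteSpace E] [NormOneClass E] (hw : IsSubexpWeight w) (s : E) (hs : ∀ n, ‖s ^ n‖ ≤ w n)
    (a : ℕ → ℂ) (ha : Summable fun n => w n * ‖a n‖)
    (hne : ∀ z : ℂ, ‖z‖ ≤ 1 → ∑' n, a n * z ^ n ≠ 0) :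
    ∃ u v : E, HasSum (fun n => a n • s ^ n) u ∧ u * v = 1 := by
  let R : NormedCommRing (Algebra.elemental ℂ s) :=
    { (inferInstance : NormedRing (Algebra.elemental ℂ s)) with
      mul_comm := fun x y => mul_comm x y }
  let N : NormedAlgebra ℂ (Algebra.elemental ℂ s) := inferInstance
  obtain ⟨_, hu, u, rfl⟩ := @isUnit_tsum_smul_pow w (Algebra.elemental ℂ s) R N inferInstance
    ⟨norm_one (α := E)⟩ hw ⟨s, Algebra.elemental.self_mem ℂ s⟩ hs a ha hne
  exact ⟨_, (↑u⁻¹ : Algebra.elemental ℂ s), hu.map (Algebra.elemental ℂ s).val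
    continuous_subtype_val, congrArg (Algebra.elemental ℂ s).val u.mul_inv⟩

/-- **Wiener's lemma** for one-sided weighted absolutely summable sequences: a power series
without zeros in the closed unit disc has an inverse with weighted summable coefficients. -/
theorem exists_inverse_of_weighted_summable (hw : IsSubexpWeight w) (a : ℕ → ℂ)
    (ha : Summable fun n => w n * ‖a n‖) (hne : ∀ z : ℂ, ‖z‖ ≤ 1 → ∑' n, a n * z ^ n ≠ 0) :
    ∃ b : ℕ → ℂ, (Summable fun n => w n * ‖b n‖) ∧
      ∀ n, ∑ m ∈ Finset.range (n + 1), a m * b (n - m) = if n = 0 then 1 else 0 := by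
  set S := weightedShift hw 1 with hS
  have : Nontrivial (lp (fun _ : ℕ => ℂ) 1) := by
    refine ⟨lp.single 1 0 1, 0, fun h => ?_⟩
    have := congrArg (fun f : lp (fun _ : ℕ => ℂ) 1 => f 0) h
    simp at this
  obtain ⟨u, G, hsumS, huG⟩ := exists_mul_eq_one_tsum_smul_pow hw S
    (fun n => by rw [hS, ← weightedShift_eq_pow]; exact norm_weightedShift_le hw n) a ha hne
  let δ : lp (fun _ : ℕ => ℂ) 1 := lp.single 1 0 1
  let g := G δ
  have hg : u g = δ := by
    calc u g = (u * G) δ := rfl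
      _ = δ := by rw [huG]; rfl
  -- The weighted shift is the ordinary shift conjugated by `w`. Dividing by `w` undoes the
  -- conjugation, and weighted summability of `b` is plain summability of `g`.
  refine ⟨fun n => g n / w n, ?_, fun n => ?_⟩
  · convert summable_norm_lp_one g using 2 with n
    rw [norm_div, Complex.norm_real, Real.norm_of_nonneg (hw.pos n).le,
      mul_div_cancel₀ _ (hw.pos n).ne']
  · have h1 : HasSum (fun m => (a m • S ^ m) g n) (δ n) := by
      have h := (hsumS.map (ContinuousLinearMap.apply ℂ _ g) (map_continuous _))
      have h2 := h.map (lp.evalCLM ℂ (fun _ : ℕ => ℂ) 1 n) (map_continuous _)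
      simp only [ContinuousLinearMap.apply_apply, hg] at h2
      exact h2
    have h3 : ∀ m, (a m • S ^ m) g n = if m ≤ n then w n * (a m * (g (n - m) / w (n - m))) else 0 := by
      intro m
      rw [hS, ← weightedShift_eq_pow]
      change a m * (weightedShift hw m g n) = _
      rw [weightedShift_apply, shiftSeq]
      split_ifs
      · push_cast; ring
      · simp
    simp only [h3] at h1
    have h4 : HasSum (fun m => if m ≤ n then w n * (a m * (g (n - m) / w (n - m))) else 0)
        (∑ m ∈ Finset.range (n + 1), w n * (a m * (g (n - m) / w (n - m)))) := by
      have h := hasSum_sum_of_ne_finset_zero (s := Finset.range (n + 1))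
        (f := fun m => if m ≤ n then w n * (a m * (g (n - m) / w (n - m))) else 0)
        (L := SummationFilter.unconditional ℕ) (fun m hm => by
          rw [if_neg (by simpa [Nat.lt_succ_iff] using hm)])
      convert h using 1
      refine Finset.sum_congr rfl fun m hm => ?_
      rw [if_pos (by simpa [Nat.lt_succ_iff] using hm)]
    have h5 := h4.unique h1
    rw [← Finset.mul_sum] at h5
    have hwn : (w n : ℂ) ≠ 0 := by exact_mod_cast (hw.pos n).ne'
    rw [← mul_right_inj' hwn, h5]
    rcases eq_or_ne n 0 with rfl | hn
    · simp [δ, hw.zero]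
    · simp [δ, hn]

end WeightedShift

/-! ### Second-order expansion of `|x + d| ^ p`. -/

section Pointwise

lemma rpow_tangent_le {r x y : ℝ} (hr : 1 ≤ r) (hx : 0 ≤ x) (hy : 0 ≤ y) :
    y ^ r + r * y ^ (r - 1) * (x - y) ≤ x ^ r := by
  rcases hy.eq_or_lt with rfl | hy
  · rcases hr.eq_or_lt with rfl | hr
    · simp
    · rw [Real.zero_rpow (by linarith), Real.zero_rpow (by linarith)]
      simpa using Real.rpow_nonneg hx r
  · have h := one_add_mul_self_le_rpow_one_add (s := x / y - 1)
      (by have := div_nonneg hx hy.le; linarith) hr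
    have h2 : (1 + (x / y - 1)) ^ r = x ^ r / y ^ r := by
      rw [← Real.div_rpow hx hy.le]; congr 1; ring
    have hyr : 0 < y ^ r := Real.rpow_pos_of_pos hy r
    rw [h2, le_div_iff₀ hyr] at h
    rw [Real.rpow_sub_one hy.ne']
    calc _ = (1 + r * (x / y - 1)) * y ^ r := by field_simp
      _ ≤ _ := h

/-- The function `z ↦ |z| ^ (p - 2) * z` has derivative `(p - 1) |z| ^ (p - 2)`, so this is a mean
value estimate. The proof separates equal from opposite signs. -/
lemma abs_rpow_mul_self_mul_le {p : ℝ} (hp : 2 ≤ p) (x y : ℝ) :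
    (|y| ^ (p - 2) * y - |x| ^ (p - 2) * x) * (y - x)
      ≤ (p - 1) * (max |x| |y|) ^ (p - 2) * (y - x) ^ 2 := by
  have key : ∀ u v : ℝ, 0 ≤ u → u ≤ v →
      v ^ (p - 2) * v - u ^ (p - 2) * u ≤ (p - 1) * v ^ (p - 2) * (v - u) := by
    intro u v hu huv
    have h := rpow_tangent_le (r := p - 1) (by linarith) hu (hu.trans huv)
    have e : ∀ z : ℝ, 0 ≤ z → z ^ (p - 1) = z ^ (p - 2) * z := fun z hz => by
      rw [← Real.rpow_add_one' hz (by linarith)]; congr 1; ring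
    rw [e u hu, e v (hu.trans huv), show p - 1 - 1 = p - 2 by ring] at h
    linarith
  have same : ∀ u v : ℝ, 0 ≤ u → 0 ≤ v → (v ^ (p - 2) * v - u ^ (p - 2) * u) * (v - u)
      ≤ (p - 1) * (max u v) ^ (p - 2) * (v - u) ^ 2 := by
    intro u v hu hv
    rcases le_total u v with h | h
    · rw [max_eq_right h]
      nlinarith [mul_le_mul_of_nonneg_right (key u v hu h) (sub_nonneg.2 h)]
    · rw [max_eq_left h]
      nlinarith [mul_le_mul_of_nonneg_right (key v u hv h) (sub_nonneg.2 h)]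
  have opp : ∀ u v : ℝ, 0 ≤ u → 0 ≤ v → (v ^ (p - 2) * v + u ^ (p - 2) * u) * (v + u)
      ≤ (p - 1) * (max u v) ^ (p - 2) * (v + u) ^ 2 := by
    intro u v hu hv
    have h1 : v ^ (p - 2) ≤ (max u v) ^ (p - 2) :=
      Real.rpow_le_rpow hv (le_max_right _ _) (by linarith)
    have h2 : u ^ (p - 2) ≤ (max u v) ^ (p - 2) :=
      Real.rpow_le_rpow hu (le_max_left _ _) (by linarith)
    have h3 : v ^ (p - 2) * v + u ^ (p - 2) * u ≤ (max u v) ^ (p - 2) * (v + u) := by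
      nlinarith [mul_le_mul_of_nonneg_right h1 hv, mul_le_mul_of_nonneg_right h2 hu]
    have h4 : 0 ≤ (max u v) ^ (p - 2) := Real.rpow_nonneg (le_max_of_le_left hu) _
    nlinarith [mul_le_mul_of_nonneg_right h3 (add_nonneg hv hu),
      mul_nonneg h4 (sq_nonneg (v + u))]
  rcases le_total 0 x with hx | hx <;> rcases le_total 0 y with hy | hy
  · rw [abs_of_nonneg hx, abs_of_nonneg hy]; exact same x y hx hy
  · rw [abs_of_nonneg hx, abs_of_nonpos hy]
    have := opp x (-y) hx (by linarith)
    nlinarith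
  · rw [abs_of_nonpos hx, abs_of_nonneg hy]
    have := opp (-x) y (by linarith) hy
    nlinarith
  · rw [abs_of_nonpos hx, abs_of_nonpos hy]
    have := same (-x) (-y) (by linarith) (by linarith)
    nlinarith

/-- Convexity is used with the tangent at `x + d`, not at `x`, which bounds `|x + d| ^ p` from
above. Moving the slope back to `x` costs the quadratic term of `abs_rpow_mul_self_mul_le`. -/
lemma abs_add_rpow_le {p : ℝ} (hp : 2 ≤ p) (x d : ℝ) :
    |x + d| ^ p ≤ |x| ^ p + p * (|x| ^ (p - 2) * x * d)
      + p * (p - 1) * 2 ^ (p - 2) * (|x| ^ (p - 2) * d ^ 2 + |d| ^ p) := by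
  have e : ∀ z : ℝ, |z| ^ p = |z| ^ (p - 2) * z ^ 2 := fun z => by
    rw [← sq_abs, ← Real.rpow_add_natCast' (abs_nonneg z) (by push_cast; linarith)]
    congr 1; push_cast; ring
  have h0 := rpow_tangent_le (r := p) (by linarith) (abs_nonneg x) (abs_nonneg (x + d))
  have e1 : |x + d| ^ (p - 1) = |x + d| ^ (p - 2) * |x + d| := by
    rw [← Real.rpow_add_one' (abs_nonneg _) (by linarith)]; congr 1; ring
  have h1 : |x + d| ^ (p - 2) * (x + d) * (x - (x + d))
      ≤ |x + d| ^ (p - 1) * (|x| - |x + d|) := by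
    rw [e1]
    have h2 : (x + d) * (x - (x + d)) ≤ |x + d| * (|x| - |x + d|) := by
      have : (x + d) * x ≤ |x + d| * |x| := by rw [← abs_mul]; exact le_abs_self _
      nlinarith [abs_mul_abs_self (x + d)]
    have := mul_le_mul_of_nonneg_left h2 (Real.rpow_nonneg (abs_nonneg (x + d)) (p - 2))
    nlinarith
  have h3 := abs_rpow_mul_self_mul_le hp x (x + d)
  have h4 : (max |x| |x + d|) ^ (p - 2) ≤ 2 ^ (p - 2) * (|x| ^ (p - 2) + |d| ^ (p - 2)) := by
    have hm : max |x| |x + d| ≤ 2 * max |x| |d| := by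
      have := abs_add_le x d
      have := le_max_left |x| |d|
      have := le_max_right |x| |d|
      have := abs_nonneg x
      exact max_le (by linarith) (by linarith)
    calc _ ≤ (2 * max |x| |d|) ^ (p - 2) :=
          Real.rpow_le_rpow (le_max_of_le_left (abs_nonneg _)) hm (by linarith)
      _ = 2 ^ (p - 2) * (max |x| |d|) ^ (p - 2) :=
          Real.mul_rpow (by norm_num) (le_max_of_le_left (abs_nonneg _))
      _ ≤ _ := by
        gcongr
        rcases max_cases |x| |d| with h | h <;> rw [h.1]
        · linarith [Real.rpow_nonneg (abs_nonneg d) (p - 2)]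
        · linarith [Real.rpow_nonneg (abs_nonneg x) (p - 2)]
  have h5 : (p - 1) * (max |x| |x + d|) ^ (p - 2) * (x + d - x) ^ 2
      ≤ (p - 1) * (2 ^ (p - 2) * (|x| ^ (p - 2) + |d| ^ (p - 2))) * d ^ 2 := by
    rw [add_sub_cancel_left]
    have : 0 ≤ p - 1 := by linarith
    gcongr
  have h6 := h3.trans h5
  rw [add_sub_cancel_left] at h6
  rw [e d]
  have hp0 : 0 ≤ p := by linarith
  have h7 := mul_le_mul_of_nonneg_left h6 hp0
  have h8 := mul_le_mul_of_nonneg_left h1 hp0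
  nlinarith

end Pointwise

/-! ### The martingale type 2 inequality in `L^p`, `p ≥ 2`. -/

section LpNorm

variable {Ω : Type*} [mΩ : MeasurableSpace Ω] {μ : Measure Ω} {p : ℝ}

lemma lpNorm_rpow_eq_integral (hp : 0 < p) {f : Ω → ℝ} (hf : AEStronglyMeasurable f μ) :
    lpNorm f (ENNReal.ofReal p) μ ^ p = ∫ ω, |f ω| ^ p ∂μ := by
  rw [lpNorm_eq_integral_norm_rpow_toReal (by simpa using hp) (by simp) hf,
    ENNReal.toReal_ofReal hp.le, Real.rpow_inv_rpow _ hp.ne']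
  · rfl
  · exact integral_nonneg fun _ => by positivity

lemma integrable_abs_rpow_iff (hp : 0 < p) {f : Ω → ℝ} (hf : AEStronglyMeasurable f μ) :
    Integrable (fun ω => |f ω| ^ p) μ ↔ MemLp f (ENNReal.ofReal p) μ := by
  rw [← integrable_norm_rpow_iff hf (by simpa using hp) (by simp), ENNReal.toReal_ofReal hp.le]
  rfl

lemma integrable_abs_rpow_mul_sq (hp : 2 ≤ p) {X D : Ω → ℝ}
    (hX : MemLp X (ENNReal.ofReal p) μ) (hD : MemLp D (ENNReal.ofReal p) μ) :
    Integrable (fun ω => |X ω| ^ (p - 2) * D ω ^ 2) μ := by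
  have hp0 : 0 < p := by linarith
  have h1 := (integrable_abs_rpow_iff hp0 hX.1).2 hX
  have h2 := (integrable_abs_rpow_iff hp0 hD.1).2 hD
  have hmX : AEMeasurable X μ := hX.1.aemeasurable
  have hmD : AEMeasurable D μ := hD.1.aemeasurable
  refine (h1.add h2).mono' (by fun_prop) (ae_of_all _ fun ω => ?_)
  have e : ∀ z : ℝ, 0 ≤ z → z ^ p = z ^ (p - 2) * z ^ 2 := fun z hz => by
    rw [← Real.rpow_add_natCast' hz (by push_cast; linarith)]
    congr 1; push_cast; ring
  rw [Real.norm_of_nonneg (by positivity), ← sq_abs (D ω)]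
  simp only [Pi.add_apply]
  rcases le_total |X ω| |D ω| with h | h
  · have : |X ω| ^ (p - 2) * |D ω| ^ 2 ≤ |D ω| ^ p := by
      rw [e _ (abs_nonneg (D ω))]; gcongr
    linarith [Real.rpow_nonneg (abs_nonneg (X ω)) p]
  · have : |X ω| ^ (p - 2) * |D ω| ^ 2 ≤ |X ω| ^ p := by
      rw [e _ (abs_nonneg (X ω))]; gcongr
    linarith [Real.rpow_nonneg (abs_nonneg (D ω)) p]

lemma integral_abs_rpow_mul_sq_le (hp : 2 ≤ p) {X D : Ω → ℝ}
    (hX : MemLp X (ENNReal.ofReal p) μ) (hD : MemLp D (ENNReal.ofReal p) μ) :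
    ∫ ω, |X ω| ^ (p - 2) * D ω ^ 2 ∂μ
      ≤ lpNorm X (ENNReal.ofReal p) μ ^ (p - 2) * lpNorm D (ENNReal.ofReal p) μ ^ 2 := by
  have hp0 : 0 < p := by linarith
  have h1 := (integrable_abs_rpow_iff hp0 hX.1).2 hX
  have h2 := (integrable_abs_rpow_iff hp0 hD.1).2 hD
  have hmX : AEMeasurable X μ := hX.1.aemeasurable
  have hmD : AEMeasurable D μ := hD.1.aemeasurable
  -- Hölder with weights `(p - 2) / p` and `2 / p`. This form includes `p = 2`, where the first
  -- weight is zero.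
  have key := ENNReal.lintegral_mul_norm_pow_le (μ := μ)
    (f := fun ω => ENNReal.ofReal (|X ω| ^ p)) (g := fun ω => ENNReal.ofReal (|D ω| ^ p))
    (by fun_prop) (by fun_prop) (p := (p - 2) / p) (q := 2 / p)
    (div_nonneg (by linarith) hp0.le) (by positivity) (by field_simp; ring)
  have e1 : ∀ ω, ENNReal.ofReal (|X ω| ^ p) ^ ((p - 2) / p) * ENNReal.ofReal (|D ω| ^ p) ^ (2 / p)
      = ENNReal.ofReal (|X ω| ^ (p - 2) * D ω ^ 2) := fun ω => by
    rw [ENNReal.ofReal_rpow_of_nonneg (by positivity) (div_nonneg (by linarith) hp0.le),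
      ENNReal.ofReal_rpow_of_nonneg (by positivity) (by positivity),
      ← ENNReal.ofReal_mul (by positivity), ← Real.rpow_mul (abs_nonneg _),
      ← Real.rpow_mul (abs_nonneg _), mul_div_cancel₀ _ hp0.ne', mul_div_cancel₀ _ hp0.ne',
      Real.rpow_two, sq_abs]
  simp only [e1] at key
  have nX : 0 ≤ lpNorm X (ENNReal.ofReal p) μ := lpNorm_nonneg
  have nD : 0 ≤ lpNorm D (ENNReal.ofReal p) μ := lpNorm_nonneg
  rw [← ofReal_integral_eq_lintegral_ofReal (integrable_abs_rpow_mul_sq hp hX hD)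
      (ae_of_all _ fun _ => by positivity),
    ← ofReal_integral_eq_lintegral_ofReal h1 (ae_of_all _ fun _ => by positivity),
    ← ofReal_integral_eq_lintegral_ofReal h2 (ae_of_all _ fun _ => by positivity),
    ← lpNorm_rpow_eq_integral hp0 hX.1, ← lpNorm_rpow_eq_integral hp0 hD.1,
    ENNReal.ofReal_rpow_of_nonneg (by positivity) (div_nonneg (by linarith) hp0.le),
    ENNReal.ofReal_rpow_of_nonneg (by positivity) (by positivity),
    ← ENNReal.ofReal_mul (by positivity), ← Real.rpow_mul lpNorm_nonneg,
    ← Real.rpow_mul lpNorm_nonneg, mul_div_cancel₀ _ hp0.ne', mul_div_cancel₀ _ hp0.ne',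
    Real.rpow_two, ENNReal.ofReal_le_ofReal_iff (by positivity)] at key
  exact key

lemma indepFun_of_measurable {m : MeasurableSpace Ω} {ξ : Ω → ℝ} {β : Type*} [MeasurableSpace β]
    {h : Ω → β} (hξ : Indep (MeasurableSpace.comap ξ inferInstance) m μ)
    (hh : Measurable[m] h) : IndepFun ξ h μ := by
  rw [IndepFun_iff_Indep]
  exact indep_of_indep_of_le_right hξ hh.comap_le

/-- Independence factorises the `p`-th moment, so the product loses no integrability exponent. -/
lemma memLp_indep_mul (hp : 0 < p) {ξ G : Ω → ℝ} (h : IndepFun ξ G μ)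
    (hξ : MemLp ξ (ENNReal.ofReal p) μ) (hG : MemLp G (ENNReal.ofReal p) μ) :
    MemLp (fun ω => ξ ω * G ω) (ENNReal.ofReal p) μ := by
  rw [← integrable_abs_rpow_iff hp (f := fun ω => ξ ω * G ω) (hξ.1.mul hG.1)]
  simp only [abs_mul, Real.mul_rpow (abs_nonneg _) (abs_nonneg _)]
  have hm : Measurable fun x : ℝ => |x| ^ p := by fun_prop
  exact (h.comp hm hm).integrable_mul ((integrable_abs_rpow_iff hp hξ.1).2 hξ)
    ((integrable_abs_rpow_iff hp hG.1).2 hG)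

lemma lpNorm_indep_mul (hp : 0 < p) {ξ G : Ω → ℝ} (h : IndepFun ξ G μ)
    (hξ : MemLp ξ (ENNReal.ofReal p) μ) (hG : MemLp G (ENNReal.ofReal p) μ) :
    lpNorm (fun ω => ξ ω * G ω) (ENNReal.ofReal p) μ
      = lpNorm ξ (ENNReal.ofReal p) μ * lpNorm G (ENNReal.ofReal p) μ := by
  have hm : Measurable fun x : ℝ => |x| ^ p := by fun_prop
  have key : lpNorm (fun ω => ξ ω * G ω) (ENNReal.ofReal p) μ ^ p
      = (lpNorm ξ (ENNReal.ofReal p) μ * lpNorm G (ENNReal.ofReal p) μ) ^ p := by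
    rw [Real.mul_rpow lpNorm_nonneg lpNorm_nonneg, lpNorm_rpow_eq_integral hp (f := fun ω => ξ ω * G ω) (hξ.1.mul hG.1),
      lpNorm_rpow_eq_integral hp hξ.1, lpNorm_rpow_eq_integral hp hG.1]
    simp only [abs_mul, Real.mul_rpow (abs_nonneg _) (abs_nonneg _)]
    exact (h.comp hm hm).integral_fun_mul_eq_mul_integral
      ((integrable_abs_rpow_iff hp hξ.1).2 hξ).1 ((integrable_abs_rpow_iff hp hG.1).2 hG).1
  exact (Real.rpow_left_inj lpNorm_nonneg (mul_nonneg lpNorm_nonneg lpNorm_nonneg) hp.ne').1 key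

/-- The constant in the martingale inequality below. -/
noncomputable def type2Const (p : ℝ) : ℝ := 2 * (p * (p - 1) * 2 ^ (p - 2)) + 1

lemma one_le_type2Const (hp : 2 ≤ p) : 1 ≤ type2Const p := by
  have : 0 ≤ p * (p - 1) := mul_nonneg (by linarith) (by linarith)
  unfold type2Const
  have : (0 : ℝ) ≤ 2 ^ (p - 2) := by positivity
  nlinarith [mul_nonneg ‹0 ≤ p * (p - 1)› this]

/-- With `T` the right-hand side, both `A ^ (p - 2)` and `d ^ (p - 2)` are at most `T ^ (p / 2 -
1)`, and this power factors out. The two error terms give `2 * C`; the extra `1` ensures `d ^ 2 ≤ T`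
even for small `C`. -/
lemma sq_le_of_rpow_le (hp : 2 ≤ p) {Z A d C : ℝ} (hZ : 0 ≤ Z) (hA : 0 ≤ A) (hd : 0 ≤ d)
    (hC : 0 ≤ C) (h : Z ^ p ≤ A ^ p + C * (A ^ (p - 2) * d ^ 2 + d ^ p)) :
    Z ^ 2 ≤ A ^ 2 + (2 * C + 1) * d ^ 2 := by
  have e : ∀ z : ℝ, 0 ≤ z → ∀ s : ℝ, z ^ (2 * s) = (z ^ 2) ^ s := fun z hz s => by
    rw [Real.rpow_mul hz, Real.rpow_two]
  have hp2 : 0 < p / 2 := by linarith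
  have h0 : (Z ^ 2) ^ (p / 2) = Z ^ p := by rw [← e Z hZ]; congr 1; ring
  have h1 : (A ^ 2) ^ (p / 2 - 1) = A ^ (p - 2) := by rw [← e A hA]; congr 1; ring
  have h2 : (d ^ 2) ^ (p / 2 - 1) = d ^ (p - 2) := by rw [← e d hd]; congr 1; ring
  have h3 : ∀ z : ℝ, 0 ≤ z → z ^ p = z ^ (p - 2) * z ^ 2 := fun z hz => by
    rw [← Real.rpow_add_natCast' hz (by push_cast; linarith)]
    congr 1; push_cast; ring
  have hnn : 0 ≤ A ^ 2 + (2 * C + 1) * d ^ 2 := by positivity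
  rw [← Real.rpow_le_rpow_iff (sq_nonneg Z) hnn hp2, h0]
  refine h.trans ?_
  set T := A ^ 2 + (2 * C + 1) * d ^ 2 with hT
  have h4 : T ^ (p / 2) = T ^ (p / 2 - 1) * T := by
    rw [← Real.rpow_add_one' hnn (by linarith)]; congr 1; ring
  have h5 : A ^ (p - 2) ≤ T ^ (p / 2 - 1) := by
    rw [← h1]
    exact Real.rpow_le_rpow (sq_nonneg A) (by rw [hT]; nlinarith [mul_nonneg hC (sq_nonneg d)])
      (by linarith)
  have h6 : d ^ (p - 2) ≤ T ^ (p / 2 - 1) := by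
    rw [← h2]
    exact Real.rpow_le_rpow (sq_nonneg d)
      (by rw [hT]; nlinarith [mul_nonneg hC (sq_nonneg d), sq_nonneg A]) (by linarith)
  rw [h4, h3 A hA, h3 d hd]
  have h7 := mul_le_mul_of_nonneg_right h5 (sq_nonneg A)
  have h8 := mul_le_mul_of_nonneg_right h5 (mul_nonneg hC (sq_nonneg d))
  have h9 := mul_le_mul_of_nonneg_right h6 (mul_nonneg hC (sq_nonneg d))
  have h10 : 0 ≤ T ^ (p / 2 - 1) * d ^ 2 := by positivity
  nlinarith

lemma lpNorm_add_indep_mul_sq_le {Ω : Type*} {m : MeasurableSpace Ω} [mΩ : MeasurableSpace Ω]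
    {μ : Measure Ω} (hp : 2 ≤ p) (hm : m ≤ mΩ)
    {ξ X G : Ω → ℝ} (hξm : Measurable ξ)
    (hind : Indep (MeasurableSpace.comap ξ inferInstance) m μ)
    (hmean : ∫ ω, ξ ω ∂μ = 0) (hX : Measurable[m] X) (hG : Measurable[m] G)
    (hξp : MemLp ξ (ENNReal.ofReal p) μ) (hXp : MemLp X (ENNReal.ofReal p) μ)
    (hGp : MemLp G (ENNReal.ofReal p) μ) :
    lpNorm (fun ω => X ω + ξ ω * G ω) (ENNReal.ofReal p) μ ^ 2
      ≤ lpNorm X (ENNReal.ofReal p) μ ^ 2 + type2Const p *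
        (lpNorm ξ (ENNReal.ofReal p) μ ^ 2 * lpNorm G (ENNReal.ofReal p) μ ^ 2) := by
  have hp0 : 0 < p := by linarith
  have hD := memLp_indep_mul hp0 (indepFun_of_measurable hind hG) hξp hGp
  have hDn := lpNorm_indep_mul hp0 (indepFun_of_measurable hind hG) hξp hGp
  have hXm : Measurable X := hX.mono hm le_rfl
  have hGm : Measurable G := hG.mono hm le_rfl
  set D : Ω → ℝ := fun ω => ξ ω * G ω with hDdef
  have hDm : Measurable D := hξm.mul hGm
  rw [← mul_pow, ← hDn]
  set C := p * (p - 1) * 2 ^ (p - 2) with hC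
  have hC0 : 0 ≤ C := mul_nonneg (mul_nonneg (by linarith) (by linarith)) (by positivity)
  refine sq_le_of_rpow_le hp lpNorm_nonneg lpNorm_nonneg lpNorm_nonneg hC0 ?_
  have i1 := (integrable_abs_rpow_iff hp0 hXp.1).2 hXp
  have i2 := (integrable_abs_rpow_iff hp0 hD.1).2 hD
  have i3 := integrable_abs_rpow_mul_sq hp hXp hD
  have i4 : Integrable (fun ω => |X ω| ^ (p - 2) * X ω * D ω) μ := by
    refine (i1.add i3).mono' (by fun_prop) (ae_of_all _ fun ω => ?_)
    have e : |X ω| ^ p = |X ω| ^ (p - 2) * X ω ^ 2 := by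
      rw [← sq_abs (X ω), ← Real.rpow_add_natCast' (abs_nonneg _) (by push_cast; linarith)]
      congr 1; push_cast; ring
    have h0 : 0 ≤ |X ω| ^ (p - 2) := by positivity
    simp only [Pi.add_apply, e]
    rw [mul_assoc, norm_mul, Real.norm_of_nonneg h0, ← mul_add]
    gcongr
    rw [Real.norm_eq_abs, abs_le]
    constructor <;> nlinarith [sq_nonneg (X ω + D ω), sq_nonneg (X ω - D ω)]
  have j1 : Integrable (fun ω => |X ω| ^ p + p * (|X ω| ^ (p - 2) * X ω * D ω)) μ :=
    i1.add (i4.const_mul p)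
  have j2 : Integrable (fun ω => C * (|X ω| ^ (p - 2) * D ω ^ 2 + |D ω| ^ p)) μ :=
    (i3.add i2).const_mul C
  -- The first-order term is `ξ` times a function of the past, so independence and centring kill it.
  have hzero : ∫ ω, |X ω| ^ (p - 2) * X ω * D ω ∂μ = 0 := by
    have hind2 : IndepFun ξ (fun ω => |X ω| ^ (p - 2) * X ω * G ω) μ :=
      indepFun_of_measurable hind (by
        have h1 : Measurable fun x : ℝ => |x| ^ (p - 2) * x := by fun_prop
        exact (h1.comp hX).mul hG)
    have := hind2.integral_fun_mul_eq_mul_integral hξm.aestronglyMeasurable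
      (by fun_prop : Measurable fun ω => |X ω| ^ (p - 2) * X ω * G ω).aestronglyMeasurable
    rw [hmean, zero_mul] at this
    rw [← this]
    congr 1; ext ω; simp only [hDdef]; ring
  rw [lpNorm_rpow_eq_integral hp0 (f := fun ω => X ω + D ω) (hXp.1.add hD.1), lpNorm_rpow_eq_integral hp0 hXp.1,
    lpNorm_rpow_eq_integral hp0 hD.1]
  calc ∫ ω, |X ω + D ω| ^ p ∂μ
      ≤ ∫ ω, (|X ω| ^ p + p * (|X ω| ^ (p - 2) * X ω * D ω)
        + C * (|X ω| ^ (p - 2) * D ω ^ 2 + |D ω| ^ p)) ∂μ :=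
        integral_mono_of_nonneg (ae_of_all _ fun _ => by positivity)
          (j1.add j2)
          (ae_of_all _ fun ω => abs_add_rpow_le hp _ _)
    _ = ∫ ω, |X ω| ^ p ∂μ + p * ∫ ω, |X ω| ^ (p - 2) * X ω * D ω ∂μ
        + C * (∫ ω, |X ω| ^ (p - 2) * D ω ^ 2 ∂μ + ∫ ω, |D ω| ^ p ∂μ) := by
        rw [integral_add j1 j2,
          integral_add i1 (i4.const_mul p), integral_const_mul, integral_const_mul,
          integral_add i3 i2]
    _ ≤ _ := by
        rw [hzero, mul_zero, add_zero]
        gcongr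
        exact integral_abs_rpow_mul_sq_le hp hXp hD

/-- Centred variables `ξ t`, each independent of the past `F t`, with finite `p`-th moment. -/
structure IsInnovation (μ : Measure Ω) (F : ℕ → MeasurableSpace Ω) (p : ℝ) (ξ : ℕ → Ω → ℝ) :
    Prop where
  mono : Monotone F
  le : ∀ t, F t ≤ mΩ
  measurable : ∀ t, Measurable[F (t + 1)] (ξ t)
  indep : ∀ t, Indep (MeasurableSpace.comap (ξ t) inferInstance) (F t) μ
  mean : ∀ t, ∫ ω, ξ t ω ∂μ = 0
  memLp : ∀ t, MemLp (ξ t) (ENNReal.ofReal p) μ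

namespace IsInnovation

variable {F : ℕ → MeasurableSpace Ω} {ξ : ℕ → Ω → ℝ} {G : ℕ → Ω → ℝ}

lemma measurable_of_lt (h : IsInnovation μ F p ξ) {s t : ℕ} (hst : s < t) :
    Measurable[F t] (ξ s) := (h.measurable s).mono (h.mono hst) le_rfl

lemma measurable_sum (h : IsInnovation μ F p ξ) {m n : ℕ}
    (hG : ∀ t ∈ Finset.Ico m n, Measurable[F t] (G t)) :
    Measurable[F n] (fun ω => ∑ t ∈ Finset.Ico m n, ξ t ω * G t ω) := by
  refine Finset.measurable_fun_sum _ fun t ht => ?_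
  have := (Finset.mem_Ico.1 ht).2
  exact (h.measurable_of_lt this).mul ((hG t ht).mono (h.mono this.le) le_rfl)

lemma memLp_mul (h : IsInnovation μ F p ξ) (hp : 2 ≤ p) {t : ℕ} {g : Ω → ℝ}
    (hG : Measurable[F t] g) (hGp : MemLp g (ENNReal.ofReal p) μ) :
    MemLp (fun ω => ξ t ω * g ω) (ENNReal.ofReal p) μ :=
  memLp_indep_mul (by linarith) (indepFun_of_measurable (h.indep t) hG) (h.memLp t) hGp

lemma memLp_sum (h : IsInnovation μ F p ξ) (hp : 2 ≤ p) {m n : ℕ}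
    (hG : ∀ t ∈ Finset.Ico m n, Measurable[F t] (G t))
    (hGp : ∀ t ∈ Finset.Ico m n, MemLp (G t) (ENNReal.ofReal p) μ) :
    MemLp (fun ω => ∑ t ∈ Finset.Ico m n, ξ t ω * G t ω) (ENNReal.ofReal p) μ :=
  memLp_finsetSum _ fun t ht => h.memLp_mul hp (hG t ht) (hGp t ht)

/-- The martingale type 2 inequality for sums of innovations with predictable coefficients. -/
theorem lpNorm_sum_sq_le (h : IsInnovation μ F p ξ) (hp : 2 ≤ p) {m n : ℕ}
    (hG : ∀ t ∈ Finset.Ico m n, Measurable[F t] (G t))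
    (hGp : ∀ t ∈ Finset.Ico m n, MemLp (G t) (ENNReal.ofReal p) μ) :
    lpNorm (fun ω => ∑ t ∈ Finset.Ico m n, ξ t ω * G t ω) (ENNReal.ofReal p) μ ^ 2
      ≤ type2Const p * ∑ t ∈ Finset.Ico m n,
        lpNorm (ξ t) (ENNReal.ofReal p) μ ^ 2 * lpNorm (G t) (ENNReal.ofReal p) μ ^ 2 := by
  rcases le_total n m with hmn | hmn
  · simp [Finset.Ico_eq_empty_of_le hmn]
  induction n, hmn using Nat.le_induction with
  | base => simp
  | succ n hmn ih =>
    have hsub : ∀ t ∈ Finset.Ico m n, t ∈ Finset.Ico m (n + 1) := fun t ht =>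
      Finset.Ico_subset_Ico_right n.le_succ ht
    have hn : n ∈ Finset.Ico m (n + 1) := by simp [hmn]
    have hG' := fun t ht => hG t (hsub t ht)
    have hGp' := fun t ht => hGp t (hsub t ht)
    simp only [Finset.sum_Ico_succ_top hmn]
    refine (lpNorm_add_indep_mul_sq_le hp (h.le n) ((h.measurable n).mono (h.le (n + 1)) le_rfl)
      (h.indep n) (h.mean n) (h.measurable_sum hG') (hG n hn) (h.memLp n)
      (h.memLp_sum hp hG' hGp') (hGp n hn)).trans ?_
    rw [mul_add]
    linarith [ih hG' hGp']

end IsInnovation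

end LpNorm

/-! ### Hölder and Cauchy–Schwarz between `L^{2q}` and `L^q`. -/

section Holder

variable {Ω : Type*} [mΩ : MeasurableSpace Ω] {μ : Measure Ω} {q : ℝ} {ι : Type*} [Fintype ι]

lemma holderTriple_two_mul (hq : 0 < q) :
    ENNReal.HolderTriple (ENNReal.ofReal (2 * q)) (ENNReal.ofReal (2 * q)) (ENNReal.ofReal q) where
  inv_add_inv_eq_inv := by
    rw [← ENNReal.ofReal_inv_of_pos (by positivity), ← ENNReal.ofReal_inv_of_pos hq,
      ← ENNReal.ofReal_add (by positivity) (by positivity)]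
    congr 1
    field_simp
    norm_num

lemma memLp_mul_of_two_mul (hq : 0 < q) {f g : Ω → ℝ}
    (hf : MemLp f (ENNReal.ofReal (2 * q)) μ) (hg : MemLp g (ENNReal.ofReal (2 * q)) μ) :
    MemLp (fun ω => f ω * g ω) (ENNReal.ofReal q) μ := by
  have := holderTriple_two_mul hq
  exact hg.mul' hf

lemma lpNorm_mul_le_of_two_mul (hq : 0 < q) {f g : Ω → ℝ}
    (hf : MemLp f (ENNReal.ofReal (2 * q)) μ) (hg : MemLp g (ENNReal.ofReal (2 * q)) μ) :
    lpNorm (fun ω => f ω * g ω) (ENNReal.ofReal q) μ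
      ≤ lpNorm f (ENNReal.ofReal (2 * q)) μ * lpNorm g (ENNReal.ofReal (2 * q)) μ := by
  have := holderTriple_two_mul hq
  have h := eLpNorm_smul_le_mul_eLpNorm (p := ENNReal.ofReal (2 * q))
    (q := ENNReal.ofReal (2 * q)) (r := ENNReal.ofReal q) hg.1 hf.1
  rw [← toReal_eLpNorm (f := fun ω => f ω * g ω) (hf.1.mul hg.1),
    ← toReal_eLpNorm hf.1, ← toReal_eLpNorm hg.1, ← ENNReal.toReal_mul]
  exact ENNReal.toReal_mono (ENNReal.mul_ne_top hf.eLpNorm_ne_top hg.eLpNorm_ne_top) h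

lemma one_le_ofReal (hq : 2 ≤ q) : 1 ≤ ENNReal.ofReal q := by
  rw [← ENNReal.ofReal_one]; exact ENNReal.ofReal_le_ofReal (by linarith)

lemma lpNorm_fun_sum_le {κ : Type*} (hq : 2 ≤ q) {s : Finset κ} {f : κ → Ω → ℝ}
    (hf : ∀ i ∈ s, MemLp (f i) (ENNReal.ofReal q) μ) :
    lpNorm (fun ω => ∑ i ∈ s, f i ω) (ENNReal.ofReal q) μ
      ≤ ∑ i ∈ s, lpNorm (f i) (ENNReal.ofReal q) μ := by
  have h := lpNorm_sum_le hf (one_le_ofReal hq)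
  rwa [show (∑ i ∈ s, f i) = fun ω => ∑ i ∈ s, f i ω by ext; simp] at h

lemma lpNorm_fun_add_le (hq : 2 ≤ q) {f g : Ω → ℝ} (hf : MemLp f (ENNReal.ofReal q) μ) :
    lpNorm (fun ω => f ω + g ω) (ENNReal.ofReal q) μ
      ≤ lpNorm f (ENNReal.ofReal q) μ + lpNorm g (ENNReal.ofReal q) μ :=
  lpNorm_add_le hf (one_le_ofReal hq)

lemma lpNorm_fun_const_mul (c : ℝ) (f : Ω → ℝ) (p : ENNReal) :
    lpNorm (fun ω => c * f ω) p μ = |c| * lpNorm f p μ := by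
  have h := lpNorm_const_smul c f μ (p := p)
  rwa [coe_nnnorm, Real.norm_eq_abs] at h

lemma memLp_sum_mul (hq : 2 ≤ q) {f g : ι → Ω → ℝ}
    (hf : ∀ l, MemLp (f l) (ENNReal.ofReal (2 * q)) μ)
    (hg : ∀ l, MemLp (g l) (ENNReal.ofReal (2 * q)) μ) :
    MemLp (fun ω => ∑ l, f l ω * g l ω) (ENNReal.ofReal q) μ :=
  memLp_finsetSum _ fun l _ => memLp_mul_of_two_mul (by linarith) (hf l) (hg l)

/-- Cauchy–Schwarz for dot products of random vectors. -/
lemma lpNorm_sum_mul_sq_le (hq : 2 ≤ q) {f g : ι → Ω → ℝ}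
    (hf : ∀ l, MemLp (f l) (ENNReal.ofReal (2 * q)) μ)
    (hg : ∀ l, MemLp (g l) (ENNReal.ofReal (2 * q)) μ) :
    lpNorm (fun ω => ∑ l, f l ω * g l ω) (ENNReal.ofReal q) μ ^ 2
      ≤ (∑ l, lpNorm (f l) (ENNReal.ofReal (2 * q)) μ ^ 2)
        * ∑ l, lpNorm (g l) (ENNReal.ofReal (2 * q)) μ ^ 2 := by
  have hq0 : 0 < q := by linarith
  refine le_trans ?_ (Finset.sum_mul_sq_le_sq_mul_sq _ _ _)
  refine pow_le_pow_left₀ lpNorm_nonneg ?_ 2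
  refine (lpNorm_fun_sum_le hq fun l _ => memLp_mul_of_two_mul hq0 (hf l) (hg l)).trans ?_
  exact Finset.sum_le_sum fun l _ => lpNorm_mul_le_of_two_mul hq0 (hf l) (hg l)

lemma lpNorm_const_real [IsProbabilityMeasure μ] (hq : 0 < q) (c : ℝ) :
    lpNorm (fun _ : Ω => c) (ENNReal.ofReal q) μ = |c| := by
  rw [lpNorm_const (by simpa using hq) (IsProbabilityMeasure.ne_zero μ)]
  simp

end Holder

section Measurability

variable {Ω : Type*} [mΩ : MeasurableSpace Ω] {μ : Measure Ω}
  {F : ℕ → MeasurableSpace Ω} {e : ℕ → Ω → ℝ} {ι : Type*} [Fintype ι]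

lemma IsInnovation.measurable_dot {p : ℝ} (h : IsInnovation μ F p e) {g : ℕ → ι → Ω → ℝ}
    {m t : ℕ} (hg : ∀ i ∈ Finset.Icc m t, ∀ l, Measurable[F i] (g i l)) (hmt : m ≤ t) :
    Measurable[F t] (fun ω => ∑ l, (∑ i ∈ Finset.Ico m t, e i ω * g i l ω) * g t l ω) := by
  refine Finset.measurable_fun_sum _ fun l _ => Measurable.mul ?_ ?_
  · exact h.measurable_sum fun i hi => hg i (Finset.Ico_subset_Icc_self hi) l
  · exact hg t (Finset.mem_Icc.2 ⟨hmt, le_rfl⟩) l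

end Measurability

namespace IsInnovation

variable {Ω : Type*} [mΩ : MeasurableSpace Ω] {μ : Measure Ω} {q L : ℝ}
  {F : ℕ → MeasurableSpace Ω} {e : ℕ → Ω → ℝ}

/-- The martingale inequality with uniform bounds on the innovations. -/
lemma lpNorm_sum_sq_le_of_le (h : IsInnovation μ F q e) (hq : 2 ≤ q)
    (hL : ∀ t, lpNorm (e t) (ENNReal.ofReal q) μ ≤ L) {G : ℕ → Ω → ℝ} {m n : ℕ} {α : ℕ → ℝ}
    (hG : ∀ t ∈ Finset.Ico m n, Measurable[F t] (G t))
    (hGp : ∀ t ∈ Finset.Ico m n, MemLp (G t) (ENNReal.ofReal q) μ)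
    (hα : ∀ t ∈ Finset.Ico m n, lpNorm (G t) (ENNReal.ofReal q) μ ^ 2 ≤ α t) :
    lpNorm (fun ω => ∑ t ∈ Finset.Ico m n, e t ω * G t ω) (ENNReal.ofReal q) μ ^ 2
      ≤ type2Const q * L ^ 2 * ∑ t ∈ Finset.Ico m n, α t := by
  refine (h.lpNorm_sum_sq_le hq hG hGp).trans ?_
  rw [mul_assoc, Finset.mul_sum _ _ (L ^ 2)]
  have := one_le_type2Const hq
  gcongr with t ht
  · exact lpNorm_nonneg
  · exact hL t
  · exact hα t ht

end IsInnovation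

/-! ### Squared length of a vector martingale transform. -/

section Innovations

variable {Ω : Type*} [mΩ : MeasurableSpace Ω] {μ : Measure Ω} {q s L : ℝ}
  {F : ℕ → MeasurableSpace Ω} {e : ℕ → Ω → ℝ} {ι : Type*} [Fintype ι]

namespace IsInnovation

lemma memLp_linear [IsProbabilityMeasure μ] (h : IsInnovation μ F q e) (hq : 2 ≤ q) (c : ℕ → ℝ) (m n : ℕ) :
    MemLp (fun ω => ∑ t ∈ Finset.Ico m n, e t ω * c t) (ENNReal.ofReal q) μ :=
  h.memLp_sum hq (G := fun t _ => c t) (fun _ _ => measurable_const) (fun _ _ => memLp_const _)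

/-- Moment bound for linear forms in innovations. -/
lemma lpNorm_linear_sq_le [IsProbabilityMeasure μ] (h : IsInnovation μ F q e) (hq : 2 ≤ q)
    (hL : ∀ t, lpNorm (e t) (ENNReal.ofReal q) μ ≤ L) (c : ℕ → ℝ) (m n : ℕ) :
    lpNorm (fun ω => ∑ t ∈ Finset.Ico m n, e t ω * c t) (ENNReal.ofReal q) μ ^ 2
      ≤ type2Const q * L ^ 2 * ∑ t ∈ Finset.Ico m n, c t ^ 2 := by
  refine h.lpNorm_sum_sq_le_of_le hq hL (G := fun t _ => c t) (fun _ _ => measurable_const)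
    (fun _ _ => memLp_const _) fun t _ => ?_
  rw [lpNorm_const_real (by linarith), sq_abs]

end IsInnovation

/-- Innovations whose centred squares are innovations too, with moments bounded by `L`. -/
structure IsSquareInnovation (μ : Measure Ω) (F : ℕ → MeasurableSpace Ω) (q s L : ℝ)
    (e : ℕ → Ω → ℝ) : Prop where
  two_le : 2 ≤ q
  nonneg : 0 ≤ s
  inn : IsInnovation μ F q e
  inn_two : IsInnovation μ F (2 * q) e
  inn_sq : IsInnovation μ F q (fun t ω => e t ω ^ 2 - s)
  norm_le : ∀ t, lpNorm (e t) (ENNReal.ofReal q) μ ≤ L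
  norm_two_le : ∀ t, lpNorm (e t) (ENNReal.ofReal (2 * q)) μ ≤ L
  norm_sq_le : ∀ t, lpNorm (fun ω => e t ω ^ 2 - s) (ENNReal.ofReal q) μ ≤ L

/-- A discrete Itô formula: each step adds `2 e_t (S_t · g_t) + e_t² |g_t|²` to `|S_t|²`. For
predictable `g`, and `s` the variance of `e`, both sums on the right are martingales. -/
lemma sum_sq_recursion (e : ℕ → ℝ) (g : ℕ → ι → ℝ) (s : ℝ) {m n : ℕ} (hmn : m ≤ n) :
    ∑ l, (∑ t ∈ Finset.Ico m n, e t * g t l) ^ 2 - s * ∑ t ∈ Finset.Ico m n, ∑ l, g t l ^ 2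
      = 2 * (∑ t ∈ Finset.Ico m n, e t * ∑ l, (∑ i ∈ Finset.Ico m t, e i * g i l) * g t l)
        + ∑ t ∈ Finset.Ico m n, (e t ^ 2 - s) * ∑ l, g t l ^ 2 := by
  induction n, hmn using Nat.le_induction with
  | base => simp
  | succ n hmn ih =>
    simp only [Finset.sum_Ico_succ_top hmn]
    have h : ∑ l, (∑ t ∈ Finset.Ico m n, e t * g t l + e n * g n l) ^ 2
        = ∑ l, (∑ t ∈ Finset.Ico m n, e t * g t l) ^ 2
          + 2 * (e n * ∑ l, (∑ t ∈ Finset.Ico m n, e t * g t l) * g n l)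
          + e n ^ 2 * ∑ l, g n l ^ 2 := by
      simp only [Finset.mul_sum, ← Finset.sum_add_distrib]
      exact Finset.sum_congr rfl fun l _ => by ring
    rw [h]
    linear_combination ih

/-- The squared length of a vector martingale transform, centred by its bracket. -/
lemma IsSquareInnovation.lpNorm_sum_sq_sub_le (h : IsSquareInnovation μ F q s L e)
    {g : ℕ → ι → Ω → ℝ} {m n : ℕ} (hmn : m ≤ n)
    (hg : ∀ t ∈ Finset.Ico m n, ∀ l, Measurable[F t] (g t l))
    (hgp : ∀ t ∈ Finset.Ico m n, ∀ l, MemLp (g t l) (ENNReal.ofReal (2 * q)) μ)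
    {α β : ℕ → ℝ}
    (hα : ∀ t ∈ Finset.Ico m n, lpNorm (fun ω => ∑ l, (∑ i ∈ Finset.Ico m t, e i ω * g i l ω)
      * g t l ω) (ENNReal.ofReal q) μ ^ 2 ≤ α t)
    (hβ : ∀ t ∈ Finset.Ico m n,
      lpNorm (fun ω => ∑ l, g t l ω ^ 2) (ENNReal.ofReal q) μ ^ 2 ≤ β t) :
    lpNorm (fun ω => ∑ l, (∑ t ∈ Finset.Ico m n, e t ω * g t l ω) ^ 2
        - s * ∑ t ∈ Finset.Ico m n, ∑ l, g t l ω ^ 2) (ENNReal.ofReal q) μ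
      ≤ 2 * √(type2Const q * L ^ 2 * ∑ t ∈ Finset.Ico m n, α t)
        + √(type2Const q * L ^ 2 * ∑ t ∈ Finset.Ico m n, β t) := by
  have hq := h.two_le
  have hsub : ∀ t ∈ Finset.Ico m n, ∀ i ∈ Finset.Ico m t, i ∈ Finset.Ico m n := fun t ht i hi => by
    simp only [Finset.mem_Ico] at *; omega
  have hm1 : ∀ t ∈ Finset.Ico m n, Measurable[F t]
      (fun ω => ∑ l, (∑ i ∈ Finset.Ico m t, e i ω * g i l ω) * g t l ω) := fun t ht =>
    h.inn.measurable_dot (fun i hi l => hg i (by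
      simp only [Finset.mem_Ico, Finset.mem_Icc] at *; omega) l) (Finset.mem_Ico.1 ht).1
  have hp1 : ∀ t ∈ Finset.Ico m n, MemLp
      (fun ω => ∑ l, (∑ i ∈ Finset.Ico m t, e i ω * g i l ω) * g t l ω) (ENNReal.ofReal q) μ :=
    fun t ht => memLp_sum_mul hq (fun l => h.inn_two.memLp_sum (by linarith)
      (fun i hi => hg i (hsub t ht i hi) l) fun i hi => hgp i (hsub t ht i hi) l)
      (fun l => hgp t ht l)
  have hm2 : ∀ t ∈ Finset.Ico m n, Measurable[F t] (fun ω => ∑ l, g t l ω ^ 2) := fun t ht =>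
    Finset.measurable_fun_sum _ fun l _ => (hg t ht l).pow_const 2
  have hp2 : ∀ t ∈ Finset.Ico m n, MemLp (fun ω => ∑ l, g t l ω ^ 2) (ENNReal.ofReal q) μ :=
    fun t ht => by
      simpa only [sq] using memLp_sum_mul hq (fun l => hgp t ht l) (fun l => hgp t ht l)
  simp only [sum_sq_recursion (fun t => e t _) (fun t l => g t l _) s hmn]
  have hM1 := h.inn.memLp_sum hq hm1 hp1
  refine (lpNorm_fun_add_le hq (hM1.const_mul 2)).trans ?_
  rw [lpNorm_fun_const_mul, abs_two]
  gcongr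
  · exact Real.le_sqrt_of_sq_le (h.inn.lpNorm_sum_sq_le_of_le hq h.norm_le hm1 hp1 hα)
  · exact Real.le_sqrt_of_sq_le (h.inn_sq.lpNorm_sum_sq_le_of_le hq h.norm_sq_le hm2 hp2 hβ)

end Innovations

/-! ### Moment bounds for the truncated score. -/

section Score

variable {Ω : Type*} [mΩ : MeasurableSpace Ω] {μ : Measure Ω}
  {q s L B D D' : ℝ} {F : ℕ → MeasurableSpace Ω} {e : ℕ → Ω → ℝ} {k : ℕ}

/-- The Bessel inequality, with constant `B`, for the first `t` members of a family of vectors. -/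
def IsBessel (B : ℝ) (t : ℕ) (c : ℕ → Fin k → ℝ) : Prop :=
  ∀ v : Fin k → ℝ, ∑ i ∈ Finset.Ico 0 t, (∑ l, c i l * v l) ^ 2 ≤ B * ∑ l, v l ^ 2

lemma IsBessel.sum_sq_le {t : ℕ} {c : ℕ → Fin k → ℝ} (h : IsBessel B t c) :
    ∑ i ∈ Finset.Ico 0 t, ∑ l, c i l ^ 2 ≤ B * k := by
  rw [Finset.sum_comm]
  calc ∑ l, ∑ i ∈ Finset.Ico 0 t, c i l ^ 2 ≤ ∑ _l : Fin k, B := by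
        refine Finset.sum_le_sum fun l _ => ?_
        have := h (Pi.single l 1)
        simpa [Pi.single_apply] using this
    _ = B * k := by simp [mul_comm]

/-- Test the Bessel inequality on `c i` itself and keep only the `i`-th term. -/
lemma IsBessel.sq_sum_sq_le {t i : ℕ} {c : ℕ → Fin k → ℝ} (h : IsBessel B t c) (hi : i < t) :
    (∑ l, c i l ^ 2) ^ 2 ≤ B * ∑ l, c i l ^ 2 := by
  refine le_trans ?_ (h (c i))
  have := Finset.single_le_sum (f := fun j => (∑ l, c j l * c i l) ^ 2)
    (fun _ _ => sq_nonneg _) (Finset.mem_Ico.2 ⟨Nat.zero_le i, hi⟩)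
  simpa only [sq] using this

lemma IsBessel.sum_Ico_le {m n t : ℕ} {c : ℕ → Fin k → ℝ} (h : IsBessel B t c) (hn : n ≤ t)
    (v : Fin k → ℝ) :
    ∑ i ∈ Finset.Ico m n, (∑ l, c i l * v l) ^ 2 ≤ B * ∑ l, v l ^ 2 :=
  (Finset.sum_le_sum_of_subset_of_nonneg (Finset.Ico_subset_Ico (Nat.zero_le m) hn)
    fun _ _ _ => sq_nonneg _).trans (h v)

lemma sum_mul_sum_comm {m n : ℕ} (x : ℕ → ℝ) (c : ℕ → Fin k → ℝ) (v : Fin k → ℝ) :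
    ∑ l, (∑ i ∈ Finset.Ico m n, x i * c i l) * v l
      = ∑ i ∈ Finset.Ico m n, x i * ∑ l, c i l * v l := by
  simp only [Finset.sum_mul, Finset.mul_sum]
  rw [Finset.sum_comm]
  simp only [mul_assoc]

/-- The vector-valued predictable process `∑_{i < t} e_i c_{t,i}`. -/
def linProc (e : ℕ → Ω → ℝ) (c : ℕ → ℕ → Fin k → ℝ) (t : ℕ) (l : Fin k) (ω : Ω) : ℝ :=
  ∑ i ∈ Finset.Ico 0 t, e i ω * c t i l

/-- The partial sums of `e_i` times the predictable process `linProc`. -/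
def partialScore (e : ℕ → Ω → ℝ) (c : ℕ → ℕ → Fin k → ℝ) (m n : ℕ) (l : Fin k) (ω : Ω) : ℝ :=
  ∑ i ∈ Finset.Ico m n, e i ω * linProc e c i l ω

/-- The deterministic data of the score: Bessel families `c t`, whose members in the remote past
have bounded total mass. -/
structure IsScoreCoeff (B D : ℝ) (c : ℕ → ℕ → Fin k → ℝ) : Prop where
  nonneg : 0 ≤ B
  nonneg' : 0 ≤ D
  bessel : ∀ t, IsBessel B t (c t)
  tail : ∀ t, ∑ i ∈ Finset.Ico 0 (t - 2 * k), ∑ l, c t i l ^ 2 ≤ D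

lemma measurable_dot_const {Ω : Type*} {m : MeasurableSpace Ω} {X : Fin k → Ω → ℝ} (hX : ∀ l, Measurable (X l))
    (v : Fin k → ℝ) : Measurable (fun ω => ∑ l, X l ω * v l) :=
  Finset.measurable_fun_sum _ fun l _ => (hX l).mul measurable_const

lemma memLp_dot_const {p : ENNReal} {X : Fin k → Ω → ℝ} (hX : ∀ l, MemLp (X l) p μ)
    (v : Fin k → ℝ) : MemLp (fun ω => ∑ l, X l ω * v l) p μ :=
  memLp_finsetSum _ fun l _ => (hX l).mul_const (v l)

namespace IsSquareInnovation

variable {c : ℕ → ℕ → Fin k → ℝ}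

lemma const_nonneg (h : IsSquareInnovation μ F q s L e) : 0 ≤ type2Const q * L ^ 2 := by
  have := one_le_type2Const h.two_le
  positivity

lemma const_two_nonneg (h : IsSquareInnovation μ F q s L e) : 0 ≤ type2Const (2 * q) * L ^ 2 := by
  have := one_le_type2Const (p := 2 * q) (by linarith [h.two_le])
  positivity

lemma measurable_linProc (h : IsSquareInnovation μ F q s L e) (t : ℕ) (l : Fin k) :
    Measurable[F t] (linProc e c t l) :=
  h.inn.measurable_sum (G := fun i _ => c t i l) fun _ _ => measurable_const

lemma measurable_partialScore (h : IsSquareInnovation μ F q s L e) (m n : ℕ) (l : Fin k) :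
    Measurable[F n] (partialScore e c m n l) :=
  h.inn.measurable_sum fun _ _ => h.measurable_linProc _ _

variable [IsProbabilityMeasure μ]

/-- Moment bound for centred quadratic forms in innovations. -/
lemma lpNorm_quadratic_le (h : IsSquareInnovation μ F q s L e) {t : ℕ} {c : ℕ → Fin k → ℝ}
    (hB0 : 0 ≤ B) (hB : IsBessel B t c) :
    lpNorm (fun ω => ∑ l, (∑ i ∈ Finset.Ico 0 t, e i ω * c i l) ^ 2
        - s * ∑ i ∈ Finset.Ico 0 t, ∑ l, c i l ^ 2) (ENNReal.ofReal q) μ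
      ≤ (2 * (type2Const q * L ^ 2) * B + √(type2Const q * L ^ 2) * B) * √k := by
  have hq := h.two_le
  set a := type2Const q * L ^ 2 with ha
  have ha0 : 0 ≤ a := h.const_nonneg
  -- Here the predictable vectors are deterministic. Bessel makes both bounds proportional to `|c
  -- i|²`, whose sum is at most `B * k`; the square root of this sum is the source of `√k`.
  refine (h.lpNorm_sum_sq_sub_le (g := fun i l _ => c i l) (Nat.zero_le t)
    (fun _ _ _ => measurable_const) (fun _ _ _ => memLp_const _)
    (α := fun i => a * (B * ∑ l, c i l ^ 2)) (β := fun i => B * ∑ l, c i l ^ 2)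
    (fun i hi => ?_) (fun i hi => ?_)).trans ?_
  · simp only [sum_mul_sum_comm (fun i => e i _)]
    refine (h.inn.lpNorm_linear_sq_le hq h.norm_le _ _ _).trans ?_
    exact mul_le_mul_of_nonneg_left (hB.sum_Ico_le (Finset.mem_Ico.1 hi).2.le _) ha0
  · rw [lpNorm_const_real (by linarith), sq_abs]
    exact hB.sq_sum_sq_le (Finset.mem_Ico.1 hi).2
  · rw [← Finset.mul_sum, ← Finset.mul_sum, add_mul]
    have h1 := hB.sum_sq_le
    have b1 : √(a * (a * (B * ∑ i ∈ Finset.Ico 0 t, ∑ l, c i l ^ 2))) ≤ a * B * √k := by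
      calc _ ≤ √(a * (a * (B * (B * k)))) := by gcongr
        _ = √((a * B) ^ 2 * k) := by congr 1; ring
        _ = _ := by rw [Real.sqrt_mul (by positivity), Real.sqrt_sq (by positivity)]
    have b2 : √(a * (B * ∑ i ∈ Finset.Ico 0 t, ∑ l, c i l ^ 2)) ≤ √a * B * √k := by
      calc _ ≤ √(a * (B * (B * k))) := by gcongr
        _ = √(a * B ^ 2 * k) := by congr 1; ring
        _ = _ := by rw [Real.sqrt_mul (by positivity), Real.sqrt_mul ha0, Real.sqrt_sq hB0]
    rw [← ha]
    linarith

lemma memLp_linProc (h : IsSquareInnovation μ F q s L e) (t : ℕ) (l : Fin k) :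
    MemLp (linProc e c t l) (ENNReal.ofReal (2 * q)) μ :=
  h.inn_two.memLp_linear (by linarith [h.two_le]) _ _ _

lemma memLp_partialScore (h : IsSquareInnovation μ F q s L e) (m n : ℕ) (l : Fin k) :
    MemLp (partialScore e c m n l) (ENNReal.ofReal (2 * q)) μ :=
  h.inn_two.memLp_sum (by linarith [h.two_le]) (fun _ _ => h.measurable_linProc _ _)
    fun _ _ => h.memLp_linProc _ _

lemma sum_lpNorm_linProc_sq_le (h : IsSquareInnovation μ F q s L e) (hc : IsScoreCoeff B D c)
    (t : ℕ) : ∑ l, lpNorm (linProc e c t l) (ENNReal.ofReal (2 * q)) μ ^ 2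
      ≤ type2Const (2 * q) * L ^ 2 * (B * k) := by
  calc _ ≤ ∑ l, type2Const (2 * q) * L ^ 2 * ∑ i ∈ Finset.Ico 0 t, c t i l ^ 2 :=
        Finset.sum_le_sum fun l _ =>
          h.inn_two.lpNorm_linear_sq_le (by linarith [h.two_le]) h.norm_two_le _ _ _
    _ ≤ _ := by
        rw [← Finset.mul_sum, Finset.sum_comm]
        exact mul_le_mul_of_nonneg_left (hc.bessel t).sum_sq_le h.const_two_nonneg

lemma lpNorm_linProc_dot_sq_le (h : IsSquareInnovation μ F q s L e) (hc : IsScoreCoeff B D c)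
    (t : ℕ) (v : Fin k → ℝ) :
    lpNorm (fun ω => ∑ l, linProc e c t l ω * v l) (ENNReal.ofReal q) μ ^ 2
      ≤ type2Const q * L ^ 2 * (B * ∑ l, v l ^ 2) := by
  simp only [linProc, sum_mul_sum_comm (fun i => e i _)]
  refine (h.inn.lpNorm_linear_sq_le h.two_le h.norm_le _ _ _).trans ?_
  exact mul_le_mul_of_nonneg_left (hc.bessel t v) h.const_nonneg

lemma memLp_of_two_mul (h : IsSquareInnovation μ F q s L e) {X : Ω → ℝ}
    (hX : MemLp X (ENNReal.ofReal (2 * q)) μ) : MemLp X (ENNReal.ofReal q) μ :=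
  hX.mono_exponent (ENNReal.ofReal_le_ofReal (by linarith [h.two_le]))

/-- In a fixed direction `v` the score has size `√N |v|` without a factor `k`; this is what the
pairing with recent innovations exploits. -/
lemma lpNorm_partialScore_dot_sq_le (h : IsSquareInnovation μ F q s L e)
    (hc : IsScoreCoeff B D c) (m n : ℕ) (v : Fin k → ℝ) :
    lpNorm (fun ω => ∑ l, partialScore e c m n l ω * v l) (ENNReal.ofReal q) μ ^ 2
      ≤ (type2Const q * L ^ 2) ^ 2 * B * ((n - m : ℕ) * ∑ l, v l ^ 2) := by
  have e1 : ∀ ω, ∑ l, partialScore e c m n l ω * v l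
      = ∑ i ∈ Finset.Ico m n, e i ω * ∑ l, linProc e c i l ω * v l := fun ω =>
    sum_mul_sum_comm (fun i => e i ω) (fun i l => linProc e c i l ω) v
  simp only [e1]
  refine (h.inn.lpNorm_sum_sq_le_of_le h.two_le h.norm_le
    (fun i _ => measurable_dot_const (fun l => h.measurable_linProc i l) v)
    (fun i _ => memLp_dot_const (fun l => h.memLp_of_two_mul (h.memLp_linProc i l)) v)
    (fun i _ => h.lpNorm_linProc_dot_sq_le hc i v)).trans_eq ?_
  rw [Finset.sum_const, Nat.card_Ico, nsmul_eq_mul]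
  ring

lemma sum_lpNorm_partialScore_sq_le (h : IsSquareInnovation μ F q s L e)
    (hc : IsScoreCoeff B D c) (m n : ℕ) :
    ∑ l, lpNorm (partialScore e c m n l) (ENNReal.ofReal (2 * q)) μ ^ 2
      ≤ (type2Const (2 * q) * L ^ 2) ^ 2 * B * ((n - m : ℕ) * k) := by
  calc _ ≤ ∑ l, type2Const (2 * q) * L ^ 2 * ∑ i ∈ Finset.Ico m n,
        lpNorm (linProc e c i l) (ENNReal.ofReal (2 * q)) μ ^ 2 :=
        Finset.sum_le_sum fun l _ => h.inn_two.lpNorm_sum_sq_le_of_le (by linarith [h.two_le])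
          h.norm_two_le (fun i _ => h.measurable_linProc i l) (fun i _ => h.memLp_linProc i l)
          (fun i _ => le_rfl)
    _ ≤ type2Const (2 * q) * L ^ 2 * ∑ i ∈ Finset.Ico m n,
          type2Const (2 * q) * L ^ 2 * (B * k) := by
        rw [← Finset.mul_sum, Finset.sum_comm]
        exact mul_le_mul_of_nonneg_left (Finset.sum_le_sum fun i _ =>
          h.sum_lpNorm_linProc_sq_le hc i) h.const_two_nonneg
    _ = _ := by
        rw [Finset.sum_const, Nat.card_Ico, nsmul_eq_mul]
        ring

/-- The part of the score close to time `t` paired with the predictable process. -/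
lemma lpNorm_near_sq_le (h : IsSquareInnovation μ F q s L e) (hc : IsScoreCoeff B D c)
    {r t N : ℕ} (hr : t ≤ r + 2 * k) (hk : (k : ℝ) ^ 2 ≤ D' * N) :
    lpNorm (fun ω => ∑ l, partialScore e c r t l ω * linProc e c t l ω) (ENNReal.ofReal q) μ ^ 2
      ≤ 2 * (type2Const (2 * q) * L ^ 2) ^ 3 * B ^ 2 * D' * (N * k) := by
  have hB0 := hc.nonneg
  set b := type2Const (2 * q) * L ^ 2 with hb
  have hb0 : 0 ≤ b := h.const_two_nonneg
  -- Cauchy–Schwarz over a window of at most `2 * k` terms gives order `k³`, and `k² ≤ D' * N` turns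
  -- this into `N * k`.
  calc _ ≤ (b ^ 2 * B * ((t - r : ℕ) * k)) * (b * (B * k)) :=
        (lpNorm_sum_mul_sq_le h.two_le (fun l => h.memLp_partialScore r t l)
          fun l => h.memLp_linProc t l).trans
          (mul_le_mul (h.sum_lpNorm_partialScore_sq_le hc r t) (h.sum_lpNorm_linProc_sq_le hc t)
            (Finset.sum_nonneg fun _ _ => sq_nonneg _) (by positivity))
    _ ≤ (b ^ 2 * B * ((2 * k) * k)) * (b * (B * k)) := by
        gcongr
        have : t - r ≤ 2 * k := by omega
        exact_mod_cast this
    _ = 2 * b ^ 3 * B ^ 2 * (k ^ 2 * k) := by ring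
    _ ≤ 2 * b ^ 3 * B ^ 2 * (D' * N * k) := by gcongr
    _ = _ := by ring

/-- The remote part of the score paired with the recent part of the predictable process. -/
lemma lpNorm_far_recent_sq_le (h : IsSquareInnovation μ F q s L e) (hc : IsScoreCoeff B D c)
    {m r t N : ℕ} (hN : r - m ≤ N) :
    lpNorm (fun ω => ∑ l, partialScore e c m r l ω * ∑ i ∈ Finset.Ico r t, e i ω * c t i l)
      (ENNReal.ofReal q) μ ^ 2 ≤ (type2Const q * L ^ 2) ^ 3 * B ^ 2 * (N * k) := by
  have hB0 := hc.nonneg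
  set a := type2Const q * L ^ 2 with ha
  have ha0 : 0 ≤ a := h.const_nonneg
  -- The remote score is known at time `r ≤ i`, so after exchanging sums the pairing is itself a
  -- martingale transform. This avoids the factor `k` lost by Cauchy–Schwarz.
  have e1 : ∀ ω, ∑ l, partialScore e c m r l ω * ∑ i ∈ Finset.Ico r t, e i ω * c t i l
      = ∑ i ∈ Finset.Ico r t, e i ω * ∑ l, partialScore e c m r l ω * c t i l := fun ω => by
    have := sum_mul_sum_comm (m := r) (n := t) (fun i => e i ω) (fun i l => c t i l)
      (fun l => partialScore e c m r l ω)
    simpa only [mul_comm] using this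
  simp only [e1]
  refine (h.inn.lpNorm_sum_sq_le_of_le h.two_le h.norm_le
    (fun i hi => measurable_dot_const (fun l => (h.measurable_partialScore m r l).mono
      (h.inn.mono (Finset.mem_Ico.1 hi).1) le_rfl) _)
    (fun i _ => memLp_dot_const (fun l => h.memLp_of_two_mul (h.memLp_partialScore m r l)) _)
    (fun i _ => h.lpNorm_partialScore_dot_sq_le hc m r (c t i))).trans ?_
  rw [← ha, ← Finset.mul_sum, ← Finset.mul_sum]
  have h1 : ∑ i ∈ Finset.Ico r t, ∑ l, c t i l ^ 2 ≤ B * k :=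
    (Finset.sum_le_sum_of_subset_of_nonneg (Finset.Ico_subset_Ico (Nat.zero_le r) le_rfl)
      fun _ _ _ => Finset.sum_nonneg fun _ _ => sq_nonneg _).trans (hc.bessel t).sum_sq_le
  calc _ ≤ a * (a ^ 2 * B * ((N : ℝ) * (B * k))) := by
        gcongr
    _ = _ := by ring

/-- The remote part of the score paired with the remote part of the predictable process. -/
lemma lpNorm_far_far_sq_le (h : IsSquareInnovation μ F q s L e) (hc : IsScoreCoeff B D c)
    {m r t N : ℕ} (hN : r - m ≤ N) (hr : r ≤ t - 2 * k) :
    lpNorm (fun ω => ∑ l, partialScore e c m r l ω * ∑ i ∈ Finset.Ico 0 r, e i ω * c t i l)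
      (ENNReal.ofReal q) μ ^ 2 ≤ (type2Const (2 * q) * L ^ 2) ^ 3 * B * D * (N * k) := by
  have hB0 := hc.nonneg
  have hD0 := hc.nonneg'
  have hq2 : 2 ≤ 2 * q := by linarith [h.two_le]
  set b := type2Const (2 * q) * L ^ 2 with hb
  have hb0 : 0 ≤ b := h.const_two_nonneg
  have h1 : ∑ l, lpNorm (fun ω => ∑ i ∈ Finset.Ico 0 r, e i ω * c t i l)
      (ENNReal.ofReal (2 * q)) μ ^ 2 ≤ b * D := by
    calc _ ≤ ∑ l, b * ∑ i ∈ Finset.Ico 0 r, c t i l ^ 2 := Finset.sum_le_sum fun l _ =>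
          h.inn_two.lpNorm_linear_sq_le hq2 h.norm_two_le _ _ _
      _ ≤ b * D := by
          rw [← Finset.mul_sum, Finset.sum_comm]
          gcongr
          exact (Finset.sum_le_sum_of_subset_of_nonneg (Finset.Ico_subset_Ico le_rfl hr)
            fun _ _ _ => Finset.sum_nonneg fun _ _ => sq_nonneg _).trans (hc.tail t)
  -- Cauchy–Schwarz is affordable here because the remote mass is bounded by `D` instead of a
  -- multiple of `k`.
  calc _ ≤ (b ^ 2 * B * ((r - m : ℕ) * k)) * (b * D) :=
        (lpNorm_sum_mul_sq_le h.two_le (fun l => h.memLp_partialScore m r l)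
          fun l => h.inn_two.memLp_linear hq2 _ _ _).trans
          (mul_le_mul (h.sum_lpNorm_partialScore_sq_le hc m r) h1
            (Finset.sum_nonneg fun _ _ => sq_nonneg _) (by positivity))
    _ ≤ (b ^ 2 * B * (N * k)) * (b * D) := by gcongr
    _ = _ := by ring

/-- The constant in the bound for the cross terms of the score. -/
def crossConst (a b B D D' : ℝ) : ℝ :=
  3 * (2 * b ^ 3 * B ^ 2 * D' + a ^ 3 * B ^ 2 + b ^ 3 * B * D)

/-- The order `N k`, against `N k²` from Cauchy–Schwarz, comes from cutting both factors at `r = t -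
2k`: near score, remote score with recent innovations, remote score with remote innovations. If `t <
m + 2k`, the whole score is near. -/
lemma lpNorm_cross_sq_le (h : IsSquareInnovation μ F q s L e) (hc : IsScoreCoeff B D c)
    (hD' : 0 ≤ D') {m t N : ℕ} (hmt : m ≤ t) (hN : t - m ≤ N) (hk : (k : ℝ) ^ 2 ≤ D' * N) :
    lpNorm (fun ω => ∑ l, partialScore e c m t l ω * linProc e c t l ω) (ENNReal.ofReal q) μ ^ 2
      ≤ crossConst (type2Const q * L ^ 2) (type2Const (2 * q) * L ^ 2) B D D' * (N * k) := by
  have hq := h.two_le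
  have hB0 := hc.nonneg
  have hD0 := hc.nonneg'
  set a := type2Const q * L ^ 2 with ha
  set b := type2Const (2 * q) * L ^ 2 with hb
  have ha0 : 0 ≤ a := h.const_nonneg
  have hb0 : 0 ≤ b := h.const_two_nonneg
  have hNk : (0 : ℝ) ≤ N * k := by positivity
  rcases Nat.lt_or_ge t (m + 2 * k) with hlt | hge
  · refine (h.lpNorm_near_sq_le hc hlt.le hk).trans ?_
    rw [← hb, crossConst]
    refine mul_le_mul_of_nonneg_right ?_ hNk
    have h1 : 0 ≤ 2 * b ^ 3 * B ^ 2 * D' := by positivity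
    have h2 : 0 ≤ a ^ 3 * B ^ 2 := by positivity
    have h3 : 0 ≤ b ^ 3 * B * D := by positivity
    linarith
  · obtain ⟨r, hr⟩ : ∃ r, t = r + 2 * k := ⟨t - 2 * k, by omega⟩
    have hmr : m ≤ r := by omega
    have hrt : r ≤ t := by omega
    have near := h.lpNorm_near_sq_le hc (r := r) (t := t) hr.le hk
    have recent := h.lpNorm_far_recent_sq_le hc (m := m) (r := r) (t := t) (N := N) (by omega)
    have far := h.lpNorm_far_far_sq_le hc (m := m) (r := r) (t := t) (N := N) (by omega) (by omega)
    have e1 : ∀ ω, ∑ l, partialScore e c m t l ω * linProc e c t l ω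
        = (∑ l, partialScore e c r t l ω * linProc e c t l ω
          + ∑ l, partialScore e c m r l ω * ∑ i ∈ Finset.Ico r t, e i ω * c t i l)
          + ∑ l, partialScore e c m r l ω * ∑ i ∈ Finset.Ico 0 r, e i ω * c t i l := fun ω => by
      rw [← Finset.sum_add_distrib, ← Finset.sum_add_distrib]
      refine Finset.sum_congr rfl fun l _ => ?_
      have h1 : partialScore e c m t l ω = partialScore e c m r l ω + partialScore e c r t l ω :=
        (Finset.sum_Ico_consecutive _ hmr hrt).symm
      have h2 : linProc e c t l ω = ∑ i ∈ Finset.Ico 0 r, e i ω * c t i l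
          + ∑ i ∈ Finset.Ico r t, e i ω * c t i l :=
        (Finset.sum_Ico_consecutive _ (Nat.zero_le r) hrt).symm
      rw [h1, h2]
      ring
    have p1 := memLp_sum_mul hq (fun l => h.memLp_partialScore (c := c) r t l)
      (fun l => h.memLp_linProc (c := c) t l)
    have p2 := memLp_sum_mul hq (fun l => h.memLp_partialScore (c := c) m r l)
      (fun l => h.inn_two.memLp_linear (by linarith) (fun i => c t i l) r t)
    simp only [e1]
    have tri := (lpNorm_fun_add_le hq (p1.add p2) (g := fun ω => ∑ l, partialScore e c m r l ω *
      ∑ i ∈ Finset.Ico 0 r, e i ω * c t i l)).trans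
      (add_le_add_left (lpNorm_fun_add_le hq p1) _)
    refine (pow_le_pow_left₀ lpNorm_nonneg tri 2).trans ?_
    have sq3 : ∀ x y z : ℝ, (x + y + z) ^ 2 ≤ 3 * (x ^ 2 + y ^ 2 + z ^ 2) := fun x y z => by
      nlinarith [sq_nonneg (x - y), sq_nonneg (y - z), sq_nonneg (x - z)]
    refine (sq3 _ _ _).trans ?_
    rw [crossConst]
    linarith

/-- The constant in the moment bound for the squared score. -/
noncomputable def scoreConst (a b s B D D' : ℝ) : ℝ :=
  2 * √(a * crossConst a b B D D') + √(a * (b * B) ^ 2 * D') + s * (2 * a * B + √a * B)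

/-- Moment bound for the squared length of the score, centred by its mean. -/
theorem lpNorm_score_le (h : IsSquareInnovation μ F q s L e) (hc : IsScoreCoeff B D c)
    (hD' : 0 ≤ D') {m n N : ℕ} (hmn : n = m + N) (hk1 : 1 ≤ k) (hk : (k : ℝ) ^ 2 ≤ D' * N) :
    lpNorm (fun ω => ∑ l, partialScore e c m n l ω ^ 2
        - s * ∑ t ∈ Finset.Ico m n, s * ∑ i ∈ Finset.Ico 0 t, ∑ l, c t i l ^ 2)
      (ENNReal.ofReal q) μ
      ≤ scoreConst (type2Const q * L ^ 2) (type2Const (2 * q) * L ^ 2) s B D D' * (N * √k) := by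
  have hq := h.two_le
  have hB0 := hc.nonneg
  have hs0 := h.nonneg
  set a := type2Const q * L ^ 2 with ha
  set b := type2Const (2 * q) * L ^ 2 with hb
  have ha0 : 0 ≤ a := h.const_nonneg
  have hb0 : 0 ≤ b := h.const_two_nonneg
  set Γ := crossConst a b B D D' with hΓ
  have hΓ0 : 0 ≤ Γ := by
    have hD0 := hc.nonneg'
    rw [hΓ, crossConst]; positivity
  have hmn' : m ≤ n := by omega
  have main := h.lpNorm_sum_sq_sub_le (g := fun t l => linProc e c t l) hmn'
    (fun t _ l => h.measurable_linProc t l) (fun t _ l => h.memLp_linProc t l)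
    (α := fun _ => Γ * (N * k)) (β := fun _ => (b * (B * k)) ^ 2)
    (fun t ht => h.lpNorm_cross_sq_le hc hD' (Finset.mem_Ico.1 ht).1
      (by have := Finset.mem_Ico.1 ht; omega) hk)
    (fun t ht => by
      have h1 := lpNorm_sum_mul_sq_le hq (fun l => h.memLp_linProc (c := c) t l)
        (fun l => h.memLp_linProc (c := c) t l)
      simp only [← sq] at h1
      refine h1.trans ?_
      have h2 := h.sum_lpNorm_linProc_sq_le hc t
      exact pow_le_pow_left₀ (Finset.sum_nonneg fun _ _ => sq_nonneg _) h2 2)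
  -- The triangle inequality over `t` suffices: each of the `N` centred quadratic forms is already
  -- `O(√k)`.
  have quad : lpNorm (fun ω => ∑ t ∈ Finset.Ico m n, (∑ l, linProc e c t l ω ^ 2
      - s * ∑ i ∈ Finset.Ico 0 t, ∑ l, c t i l ^ 2)) (ENNReal.ofReal q) μ
      ≤ N * ((2 * a * B + √a * B) * √k) := by
    refine (lpNorm_fun_sum_le hq fun t _ => ?_).trans ?_
    · refine MemLp.sub ?_ (memLp_const _)
      simpa only [sq] using memLp_sum_mul hq (fun l => h.memLp_linProc (c := c) t l)
        (fun l => h.memLp_linProc (c := c) t l)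
    · refine (Finset.sum_le_sum fun t _ => h.lpNorm_quadratic_le hB0 (hc.bessel t)).trans_eq ?_
      rw [Finset.sum_const, Nat.card_Ico, nsmul_eq_mul, hmn, Nat.add_sub_cancel_left]
  have e1 : ∀ ω, ∑ l, partialScore e c m n l ω ^ 2
        - s * ∑ t ∈ Finset.Ico m n, s * ∑ i ∈ Finset.Ico 0 t, ∑ l, c t i l ^ 2
      = (∑ l, (∑ t ∈ Finset.Ico m n, e t ω * linProc e c t l ω) ^ 2
        - s * ∑ t ∈ Finset.Ico m n, ∑ l, linProc e c t l ω ^ 2)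
        + s * ∑ t ∈ Finset.Ico m n, (∑ l, linProc e c t l ω ^ 2
          - s * ∑ i ∈ Finset.Ico 0 t, ∑ l, c t i l ^ 2) := fun ω => by
    rw [Finset.sum_sub_distrib]
    simp only [partialScore]
    ring
  simp only [e1]
  have p1 : MemLp (fun ω => ∑ l, (∑ t ∈ Finset.Ico m n, e t ω * linProc e c t l ω) ^ 2
        - s * ∑ t ∈ Finset.Ico m n, ∑ l, linProc e c t l ω ^ 2) (ENNReal.ofReal q) μ := by
    have p2 : MemLp (fun ω => ∑ l, partialScore e c m n l ω ^ 2) (ENNReal.ofReal q) μ := by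
      simpa only [sq] using memLp_sum_mul hq (fun l => h.memLp_partialScore (c := c) m n l)
        (fun l => h.memLp_partialScore (c := c) m n l)
    have p3 : MemLp (fun ω => ∑ t ∈ Finset.Ico m n, ∑ l, linProc e c t l ω ^ 2)
        (ENNReal.ofReal q) μ := by
      refine memLp_finsetSum _ fun t _ => ?_
      simpa only [sq] using memLp_sum_mul hq (fun l => h.memLp_linProc (c := c) t l)
        (fun l => h.memLp_linProc (c := c) t l)
    exact p2.sub (p3.const_mul s)
  refine (lpNorm_fun_add_le hq p1).trans ?_
  rw [lpNorm_fun_const_mul, abs_of_nonneg hs0]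
  simp only [Finset.sum_const, Nat.card_Ico, nsmul_eq_mul, hmn, Nat.add_sub_cancel_left] at main
  rw [hmn] at quad ⊢
  have b1 : √(a * (N * (Γ * (N * k)))) = √(a * Γ) * (N * √k) := by
    rw [show a * (N * (Γ * (N * k))) = a * Γ * (N ^ 2 * k) by ring,
      Real.sqrt_mul (x := a * Γ) (by positivity), Real.sqrt_mul (x := (N : ℝ) ^ 2) (by positivity),
      Real.sqrt_sq (by positivity)]
  -- The bound `N k² ≤ D' N² k` follows from `k² ≤ D' N` and `1 ≤ k`.
  have b2 : √(a * (N * (b * (B * k)) ^ 2)) ≤ √(a * (b * B) ^ 2 * D') * (N * √k) := by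
    rw [show (N : ℝ) * √k = √(N ^ 2 * k) by
      rw [Real.sqrt_mul (by positivity), Real.sqrt_sq (by positivity)],
      ← Real.sqrt_mul (by positivity)]
    apply Real.sqrt_le_sqrt
    have hk1' : (1 : ℝ) ≤ k := by exact_mod_cast hk1
    have h1 : (N : ℝ) * k ^ 2 ≤ N * (D' * N) * k := by
      have : (N : ℝ) * k ^ 2 ≤ N * (D' * N) := by gcongr
      have h0 : (0 : ℝ) ≤ N * (D' * N) := by positivity
      nlinarith
    calc a * (N * (b * (B * k)) ^ 2) = a * (b * B) ^ 2 * (N * k ^ 2) := by ring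
      _ ≤ a * (b * B) ^ 2 * (N * (D' * N) * k) := by gcongr
      _ = _ := by ring
  rw [b1] at main
  have q1 := mul_le_mul_of_nonneg_left quad hs0
  rw [scoreConst]
  linarith

end IsSquareInnovation

end Score

/-! ### Random series and inversion of the autoregression. -/

section AntidiagonalSums

variable {V : Type*} [AddCommMonoid V] [TopologicalSpace V] [ContinuousAdd V] [RegularSpace V]

lemma HasSum.sum_range_of_prod {u : ℕ × ℕ → V} {x : V} (hu : HasSum u x) :
    HasSum (fun n => ∑ i ∈ Finset.range (n + 1), u (i, n - i)) x := by
  have h := (Finset.HasAntidiagonal.sigmaAntidiagonalEquivProd (A := ℕ)).hasSum_iff.2 hu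
  have h2 := h.sigma (g := fun n => ∑ i ∈ Finset.range (n + 1), u (i, n - i)) fun n => by
    have := hasSum_fintype (fun c : Finset.HasAntidiagonal.antidiagonal n => u c)
    rw [Finset.sum_coe_sort (Finset.HasAntidiagonal.antidiagonal n) u,
      Finset.Nat.sum_antidiagonal_eq_sum_range_succ_mk] at this
    exact this
  exact h2

end AntidiagonalSums

section Series

variable {Ω : Type*} [MeasurableSpace Ω] {μ : Measure Ω} [IsProbabilityMeasure μ]

/-- By Tonelli the expected absolute sum is at most `K ∑ |c i|`, the `L¹` norm being dominated by
the `L²` norm. -/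
lemma ae_summable_of_bounded {ι : Type*} [Countable ι] {c : ι → ℝ} (hc : Summable fun i => |c i|)
    {f : ι → Ω → ℝ} (hf : ∀ i, MemLp (f i) 2 μ) {K : ℝ} (hK : ∀ i, lpNorm (f i) 2 μ ≤ K) :
    ∀ᵐ ω ∂μ, Summable fun i => c i * f i ω := by
  have h1 : ∀ i, ∫⁻ ω, ‖c i * f i ω‖ₑ ∂μ ≤ ENNReal.ofReal (|c i| * K) := fun i => by
    have h2 : ∫⁻ ω, ‖f i ω‖ₑ ∂μ ≤ ENNReal.ofReal K := by
      rw [← eLpNorm_one_eq_lintegral_enorm]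
      refine (eLpNorm_le_eLpNorm_of_exponent_le (by norm_num : (1 : ENNReal) ≤ 2) (hf i).1).trans ?_
      rw [← ofReal_lpNorm (hf i)]
      exact ENNReal.ofReal_le_ofReal (hK i)
    simp only [enorm_mul]
    rw [lintegral_const_mul' _ _ enorm_ne_top, ENNReal.ofReal_mul (abs_nonneg _),
      ← Real.enorm_eq_ofReal_abs]
    gcongr
  have h3 : ∫⁻ ω, ∑' i, ‖c i * f i ω‖ₑ ∂μ ≠ ⊤ := by
    rw [lintegral_tsum fun i => ((hf i).1.const_mul (c i)).enorm]
    refine ne_top_of_le_ne_top ?_ (ENNReal.tsum_le_tsum h1)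
    exact (hc.mul_right K).tsum_ofReal_ne_top
  have h4 : AEMeasurable (fun ω => ∑' i, ‖c i * f i ω‖ₑ) μ :=
    AEMeasurable.tsum fun i => ((hf i).1.const_mul (c i)).enorm
  filter_upwards [ae_lt_top' h4 h3] with ω hω
  have h5 : Summable fun i => ‖c i * f i ω‖₊ := ENNReal.tsum_coe_ne_top_iff_summable.1 hω.ne
  exact h5.of_nnnorm

/-- The series converges absolutely in `L²`. Its `L²` limit and its almost sure limit are both
limits in measure of the partial sums, hence agree. -/
lemma hasSum_toLp_of_ae_hasSum {c : ℕ → ℝ} (hc : Summable fun i => |c i|)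
    {f : ℕ → Ω → ℝ} (hf : ∀ i, MemLp (f i) 2 μ) {K : ℝ} (hK : ∀ i, lpNorm (f i) 2 μ ≤ K)
    {g : Ω → ℝ} (hg : MemLp g 2 μ) (h : ∀ᵐ ω ∂μ, HasSum (fun i => c i * f i ω) (g ω)) :
    HasSum (fun i => c i • (hf i).toLp (f i)) (hg.toLp g) := by
  have hs : Summable fun i => c i • (hf i).toLp (f i) := by
    refine Summable.of_norm_bounded (hc.mul_right K) fun i => ?_
    rw [norm_smul, Lp.norm_toLp, toReal_eLpNorm (hf i).1, Real.norm_eq_abs]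
    exact mul_le_mul_of_nonneg_left (hK i) (abs_nonneg _)
  obtain ⟨Y, hY⟩ := hs
  have h1 : ∀ n : ℕ, ((∑ i ∈ Finset.range n, c i • (hf i).toLp (f i) : Lp ℝ 2 μ) : Ω → ℝ)
      =ᵐ[μ] fun ω => ∑ i ∈ Finset.range n, c i * f i ω := fun n => by
    have e1 : (∑ i ∈ Finset.range n, c i • (hf i).toLp (f i) : Lp ℝ 2 μ)
        = (memLp_finsetSum (Finset.range n) fun i _ => (hf i).const_mul (c i)).toLp
          (fun ω => ∑ i ∈ Finset.range n, c i * f i ω) := by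
      induction n with
      | zero => rfl
      | succ n ih =>
        rw [Finset.sum_range_succ, ih, ← MemLp.toLp_const_smul, ← MemLp.toLp_add]
        congr 1
        ext ω
        simp [Finset.sum_range_succ]
    rw [e1]
    exact MemLp.coeFn_toLp _
  have h2 : TendstoInMeasure μ (fun n : ℕ =>
      ((∑ i ∈ Finset.range n, c i • (hf i).toLp (f i) : Lp ℝ 2 μ) : Ω → ℝ)) atTop Y :=
    tendstoInMeasure_of_tendsto_Lp hY.tendsto_sum_nat
  have h3 : TendstoInMeasure μ (fun n : ℕ =>
      ((∑ i ∈ Finset.range n, c i • (hf i).toLp (f i) : Lp ℝ 2 μ) : Ω → ℝ)) atTop g := by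
    refine tendstoInMeasure_of_tendsto_ae (fun n => (Lp.aestronglyMeasurable _)) ?_
    filter_upwards [h, ae_all_iff.2 h1] with ω hω h1ω
    simp only [h1ω]
    exact hω.tendsto_sum_nat
  have h4 : (Y : Ω → ℝ) =ᵐ[μ] g := tendstoInMeasure_ae_unique h2 h3
  have : hg.toLp g = Y := Lp.ext ((MemLp.coeFn_toLp hg).trans h4.symm)
  rwa [this]

/-- Inversion of an absolutely summable autoregression. -/
lemma ae_hasSum_of_autoregression {a b : ℕ → ℝ} (ha : Summable fun i => |a i|)
    (hb : Summable fun i => |b i|)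
    (hab : ∀ n, ∑ i ∈ Finset.range (n + 1), a i * b (n - i) = if n = 0 then 1 else 0)
    {x e : ℤ → Ω → ℝ} (hx : ∀ t, MemLp (x t) 2 μ) {K : ℝ} (hK : ∀ t, lpNorm (x t) 2 μ ≤ K)
    (h : ∀ t : ℤ, ∀ᵐ ω ∂μ, HasSum (fun i : ℕ => a i * x (t - i) ω) (e t ω)) (t : ℤ) :
    ∀ᵐ ω ∂μ, HasSum (fun m : ℕ => b m * e (t - m) ω) (x t ω) := by
  -- The double series `∑ a_i b_m x_{t-m-i}` converges absolutely almost surely. Summed along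
  -- antidiagonals it is `x_t`; summed over `i` first it is `∑ b_m e_{t-m}`.
  have hs := ae_summable_of_bounded (ι := ℕ × ℕ) (c := fun p => a p.1 * b p.2)
    (by simpa [abs_mul] using ha.mul_of_nonneg hb (fun _ => abs_nonneg _) fun _ => abs_nonneg _)
    (f := fun p => x (t - p.2 - p.1)) (fun p => hx _) (fun p => hK _)
  filter_upwards [hs, ae_all_iff.2 h] with ω hω hAR
  obtain ⟨y, hy⟩ := hω
  have h1 := hy.sum_range_of_prod
  have h2 : ∀ n : ℕ, ∑ i ∈ Finset.range (n + 1),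
      a i * b (n - i) * x (t - ((n - i : ℕ) : ℤ) - i) ω = if n = 0 then x t ω else 0 := fun n => by
    have : ∀ i ∈ Finset.range (n + 1), a i * b (n - i) * x (t - ((n - i : ℕ) : ℤ) - i) ω
        = a i * b (n - i) * x (t - n) ω := fun i hi => by
      have hi' : i ≤ n := Nat.lt_succ_iff.1 (Finset.mem_range.1 hi)
      rw [show t - ((n - i : ℕ) : ℤ) - i = t - n by push_cast [hi']; ring]
    rw [Finset.sum_congr rfl this, ← Finset.sum_mul, hab]
    split_ifs with h0 <;> simp [h0]
  simp only [h2] at h1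
  have h3 : y = x t ω := h1.unique (hasSum_ite_eq 0 (x t ω))
  have h4 := (Equiv.prodComm ℕ ℕ).hasSum_iff.2 hy
  have h5 := h4.prod_fiberwise (g := fun m : ℕ => b m * e (t - m) ω) fun m => by
    have := (hAR (t - m)).mul_left (b m)
    refine (congrArg (HasSum · (b m * e (t - m) ω)) (funext fun i => ?_)).mpr this
    change a i * b m * x (t - m - i) ω = _
    ring
  rwa [h3] at h5

end Series

/-! ### Real coefficients of the moving average representation. -/

section WienerReal

lemma exists_inverse_arSeries {a : ℕ → ℝ} (hne : ∀ z : ℂ, ‖z‖ ≤ 1 → arSeries a z ≠ 0)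
    (hs : Summable (fun i : ℕ => |((i : ℝ) + 1) ^ (1 / 2 : ℝ) * a (i + 1)|)) :
    ∃ a' b : ℕ → ℝ, a' 0 = 1 ∧ (∀ i, a' (i + 1) = a (i + 1)) ∧ (Summable fun i => |a' i|) ∧
      (Summable fun n : ℕ => √((n : ℝ) + 1) * |b n|) ∧
      ∀ n, ∑ i ∈ Finset.range (n + 1), a' i * b (n - i) = if n = 0 then 1 else 0 := by
  set a' : ℕ → ℝ := fun n => if n = 0 then 1 else a n with ha'
  have hsucc : ∀ i, a' (i + 1) = a (i + 1) := fun i => by simp [ha']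
  have hw : Summable fun n : ℕ => √((n : ℝ) + 1) * ‖(a' n : ℂ)‖ := by
    rw [← summable_nat_add_iff 1]
    -- After the index shift the weight is `√(n + 2) ≤ √2 * √(n + 1)`.
    refine Summable.of_nonneg_of_le (fun n => by positivity) (fun n => ?_) (hs.mul_left √2)
    rw [abs_mul, abs_of_nonneg (by positivity : (0 : ℝ) ≤ ((n : ℝ) + 1) ^ (1 / 2 : ℝ)),
      ← Real.sqrt_eq_rpow, ← mul_assoc, ← Real.sqrt_mul (by norm_num), Complex.norm_real, hsucc,
      Real.norm_eq_abs]
    gcongr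
    push_cast
    linarith [Nat.cast_nonneg (α := ℝ) n]
  have hone : ∀ n : ℕ, (1 : ℝ) ≤ √((n : ℝ) + 1) := fun n => by
    rw [Real.one_le_sqrt]; linarith [Nat.cast_nonneg (α := ℝ) n]
  have hs1 : Summable fun n => |a' n| := by
    refine Summable.of_nonneg_of_le (fun _ => abs_nonneg _) (fun n => ?_) hw
    rw [Complex.norm_real, Real.norm_eq_abs]
    nlinarith [hone n, abs_nonneg (a' n)]
  obtain ⟨b, hb, hab⟩ := exists_inverse_of_weighted_summable isSubexpWeight_sqrt
    (fun n => (a' n : ℂ)) hw fun z hz => by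
      have hsz : Summable fun n => (a' n : ℂ) * z ^ n := by
        refine Summable.of_norm_bounded hs1 fun n => ?_
        rw [norm_mul, norm_pow, Complex.norm_real, Real.norm_eq_abs]
        exact mul_le_of_le_one_right (abs_nonneg _) (pow_le_one₀ (norm_nonneg _) hz)
      rw [hsz.tsum_eq_zero_add]
      simpa [hsucc, arSeries, ha'] using hne z hz
  -- Since `a'` is real, the real part of the complex inverse is still an inverse.
  refine ⟨a', fun n => (b n).re, by simp [ha'], hsucc, hs1, ?_, fun n => ?_⟩
  · refine Summable.of_nonneg_of_le (fun n => by positivity) (fun n => ?_) hb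
    gcongr
    exact Complex.abs_re_le_norm _
  · have := congrArg Complex.re (hab n)
    simp only [Complex.re_sum, Complex.re_ofReal_mul] at this
    rw [this]
    split_ifs <;> simp

end WienerReal

/-! ### Innovation coefficients of the lag vector. -/

section LagCoeff

variable {k : ℕ}

/-- The coefficient of the `s`-th innovation in the `l`-th lag of the process at time `t - 1`. -/
def lagCoeff (b : ℕ → ℝ) (t s : ℕ) (l : Fin k) : ℝ :=
  if s + l + 1 ≤ t then b (t - 1 - l - s) else 0

lemma sum_lagCoeff_smul {V : Type*} [AddCommGroup V] [Module ℝ V] (b : ℕ → ℝ) (t : ℕ) (l : Fin k)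
    (f : ℕ → V) :
    ∑ s ∈ Finset.Ico 0 t, lagCoeff b t s l • f s
      = ∑ m ∈ Finset.range (t - l), b m • f (t - 1 - l - m) := by
  rw [← Finset.range_eq_Ico,
    ← Finset.sum_range_reflect (fun m : ℕ => b m • f (t - 1 - l - m))]
  refine (Finset.sum_subset_zero_on_sdiff (Finset.range_mono (Nat.sub_le t l))
    (fun s hs => ?_) fun s hs => ?_).symm
  · simp only [Finset.mem_sdiff, Finset.mem_range] at hs
    rw [lagCoeff, if_neg (by omega), zero_smul]
  · rw [Finset.mem_range] at hs
    rw [lagCoeff, if_pos (by omega)]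
    congr 2 <;> omega

lemma summable_mul_sq_of_summable_sqrt_mul {b : ℕ → ℝ}
    (hb : Summable fun n : ℕ => √((n : ℝ) + 1) * |b n|) :
    Summable fun n : ℕ => ((n : ℝ) + 1) * b n ^ 2 := by
  refine Summable.of_nonneg_of_le (fun n => by positivity) (fun n => ?_)
    (hb.mul_left (∑' n : ℕ, √((n : ℝ) + 1) * |b n|))
  have h1 : ((n : ℝ) + 1) * b n ^ 2 = (√((n : ℝ) + 1) * |b n|) * (√((n : ℝ) + 1) * |b n|) := by
    rw [mul_mul_mul_comm, Real.mul_self_sqrt (by positivity), abs_mul_abs_self, sq]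
  rw [h1]
  gcongr
  exact hb.le_tsum n fun _ _ => by positivity

/-- An innovation more than `2k` steps back enters each of the `k` lags through some `b m` with `m ≥
k`. One lag therefore contributes at most `W / k`, and `k` lags at most `W`. This is where the
weight `i^{1/2}` is used. -/
lemma sum_lagCoeff_sq_tail_le {b : ℕ → ℝ} (hb : Summable fun n : ℕ => ((n : ℝ) + 1) * b n ^ 2)
    (t : ℕ) :
    ∑ s ∈ Finset.Ico 0 (t - 2 * k), ∑ l : Fin k, lagCoeff b t s l ^ 2
      ≤ ∑' n : ℕ, ((n : ℝ) + 1) * b n ^ 2 := by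
  set W := ∑' n : ℕ, ((n : ℝ) + 1) * b n ^ 2 with hW
  rcases Nat.eq_zero_or_pos k with rfl | hk
  · simpa using tsum_nonneg fun n : ℕ => (by positivity : 0 ≤ ((n : ℝ) + 1) * b n ^ 2)
  have hk' : (0 : ℝ) < k := by exact_mod_cast hk
  rw [Finset.sum_comm]
  have key : ∀ l : Fin k, ∑ s ∈ Finset.Ico 0 (t - 2 * k), lagCoeff b t s l ^ 2 ≤ W / k := by
    intro l
    have hl := l.isLt
    rw [le_div_iff₀ hk', Finset.sum_mul]
    have hinj : Set.InjOn (fun s => t - 1 - l - s) (Finset.Ico 0 (t - 2 * k) : Finset ℕ) := by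
      intro s hs s' hs' h
      simp only [Finset.coe_Ico, Set.mem_Ico] at hs hs' h
      omega
    calc ∑ s ∈ Finset.Ico 0 (t - 2 * k), lagCoeff b t s l ^ 2 * k
        ≤ ∑ s ∈ Finset.Ico 0 (t - 2 * k),
          (((t - 1 - l - s : ℕ) : ℝ) + 1) * b (t - 1 - l - s) ^ 2 := by
          refine Finset.sum_le_sum fun s hs => ?_
          have hs' := (Finset.mem_Ico.1 hs).2
          rw [lagCoeff, if_pos (by omega), mul_comm]
          gcongr
          exact_mod_cast (by omega : k ≤ t - 1 - l - s + 1)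
      _ = ∑ m ∈ (Finset.Ico 0 (t - 2 * k)).image (fun s => t - 1 - l - s),
          ((m : ℝ) + 1) * b m ^ 2 := 
          (Finset.sum_image (f := fun m : ℕ => ((m : ℝ) + 1) * b m ^ 2) hinj).symm
      _ ≤ W := hb.sum_le_tsum _ fun _ _ => by positivity
  calc _ ≤ ∑ _l : Fin k, W / k := Finset.sum_le_sum fun l _ => key l
    _ = W := by
      rw [Finset.sum_const, Finset.card_univ, Fintype.card_fin, nsmul_eq_mul]
      field_simp

end LagCoeff

/-! ### Second-order theory in a Hilbert space. -/

section LinearProcess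

variable {H : Type*} [NormedAddCommGroup H] [InnerProductSpace ℝ H] {a b : ℕ → ℝ} {σ : ℝ}
  {X E : ℤ → H} {k : ℕ}

/-- A stationary curve `X` in a Hilbert space, related to an orthogonal sequence `E` by mutually
inverse one-sided filters. -/
structure IsLinearProcess (a b : ℕ → ℝ) (σ : ℝ) (X E : ℤ → H) : Prop where
  orth : ∀ s t, inner ℝ (E s) (E t) = if s = t then σ ^ 2 else 0
  stat : ∀ s t h, inner ℝ (X (s + h)) (X (t + h)) = inner ℝ (X s) (X t)
  ar : ∀ t, HasSum (fun i : ℕ => a i • X (t - i)) (E t)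
  ma : ∀ t, HasSum (fun m : ℕ => b m • E (t - m)) (X t)
  summable : Summable fun i => |a i|

/-- The linear combination `∑_l v_l X_{t-l}` of lags. -/
def lagComb (X : ℤ → H) (t : ℤ) (v : Fin k → ℝ) : H := ∑ l : Fin k, v l • X (t - (l : ℕ))

namespace IsLinearProcess

lemma norm_sum_smul_sq (h : IsLinearProcess a b σ X E) {ι : Type*} (S : Finset ι) (c : ι → ℝ)
    {f : ι → ℤ} (hf : Function.Injective f) :
    ‖∑ i ∈ S, c i • E (f i)‖ ^ 2 = σ ^ 2 * ∑ i ∈ S, c i ^ 2 := by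
  classical
  rw [← real_inner_self_eq_norm_sq, sum_inner, Finset.mul_sum]
  refine Finset.sum_congr rfl fun i hi => ?_
  rw [inner_sum, Finset.sum_eq_single i]
  · rw [real_inner_smul_left, real_inner_smul_right, h.orth, if_pos rfl]; ring
  · intro j _ hj
    rw [real_inner_smul_left, real_inner_smul_right, h.orth, if_neg (fun e => hj (hf e).symm)]
    ring
  · exact fun h => absurd hi h

lemma norm_lagComb (h : IsLinearProcess a b σ X E) (t t' : ℤ) (v : Fin k → ℝ) :
    ‖lagComb X t v‖ = ‖lagComb X t' v‖ := by
  have e : ‖lagComb X t v‖ ^ 2 = ‖lagComb X t' v‖ ^ 2 := by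
    rw [← real_inner_self_eq_norm_sq, ← real_inner_self_eq_norm_sq]
    simp only [lagComb, sum_inner, inner_sum, real_inner_smul_left, real_inner_smul_right]
    refine Finset.sum_congr rfl fun i _ => Finset.sum_congr rfl fun j _ => ?_
    have := h.stat (t' - (j : ℕ)) (t' - (i : ℕ)) (t - t')
    rw [show t' - ((j : ℕ) : ℤ) + (t - t') = t - (j : ℕ) by ring,
      show t' - ((i : ℕ) : ℤ) + (t - t') = t - (i : ℕ) by ring] at this
    rw [this]
  exact (pow_left_inj₀ (norm_nonneg _) (norm_nonneg _) two_ne_zero).1 e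

lemma hasSum_lagComb (h : IsLinearProcess a b σ X E) (t : ℤ) (v : Fin k → ℝ) :
    HasSum (fun i : ℕ => a i • lagComb X (t - i) v) (lagComb E t v) := by
  have := hasSum_sum (s := Finset.univ) fun (l : Fin k) _ =>
    (h.ar (t - (l : ℕ))).const_smul (v l)
  refine (congrArg (HasSum · (lagComb E t v)) (funext fun i => ?_)).mpr this
  simp only [lagComb, Finset.smul_sum]
  refine Finset.sum_congr rfl fun l _ => ?_
  rw [smul_comm, show t - (i : ℤ) - ((l : ℕ) : ℤ) = t - ((l : ℕ) : ℤ) - i by ring]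

/-- The covariance form of the process dominates a multiple of the identity. -/
lemma sq_mul_sum_sq_le (h : IsLinearProcess a b σ X E) (t : ℤ) (v : Fin k → ℝ) :
    σ ^ 2 * ∑ l, v l ^ 2 ≤ (∑' i, |a i|) ^ 2 * ‖lagComb X t v‖ ^ 2 := by
  have h1 : ‖lagComb E t v‖ ^ 2 = σ ^ 2 * ∑ l, v l ^ 2 :=
    h.norm_sum_smul_sq _ v (f := fun l : Fin k => t - (l : ℕ)) fun i j hij => by
      simp only [sub_right_inj, Nat.cast_inj] at hij
      exact Fin.ext hij
  -- The combination of noise lags is the autoregressive filter applied to the combination of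
  -- process lags, whose time shifts all have the same norm.
  have h2 : ‖lagComb E t v‖ ≤ (∑' i, |a i|) * ‖lagComb X t v‖ := by
    rw [← (h.hasSum_lagComb t v).tsum_eq, ← tsum_mul_right]
    refine tsum_of_norm_bounded (h.summable.mul_right _).hasSum fun i => ?_
    rw [norm_smul, Real.norm_eq_abs, h.norm_lagComb (t - i) t]
  rw [← h1, ← mul_pow]
  exact pow_le_pow_left₀ (norm_nonneg _) h2 2

lemma inner_lag (h : IsLinearProcess a b σ X E) (t s : ℕ) (l : Fin k) :
    inner ℝ (X ((t : ℤ) - 1 - (l : ℕ))) (E s) = σ ^ 2 * lagCoeff b t s l := by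
  have h1 : HasSum (fun m : ℕ => inner ℝ (b m • E ((t : ℤ) - 1 - (l : ℕ) - m)) (E s))
      (inner ℝ (X ((t : ℤ) - 1 - (l : ℕ))) (E s)) :=
    (h.ma _).mapL ((innerSL ℝ).flip (E s))
  refine h1.unique ?_
  simp only [real_inner_smul_left, h.orth]
  by_cases hs : s + l + 1 ≤ t
  · rw [lagCoeff, if_pos hs]
    convert hasSum_single (t - 1 - l - s) _ using 1
    · rw [if_pos (by omega)]; ring
    · intro m hm
      rw [if_neg (by omega), mul_zero]
  · rw [lagCoeff, if_neg hs, mul_zero]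
    convert hasSum_zero with m
    rw [if_neg (by omega), mul_zero]

/-- The Bessel inequality for the coefficients of a combination of lags. -/
lemma sq_mul_sum_lagCoeff_sq_le (h : IsLinearProcess a b σ X E) (t : ℕ) (t' : ℤ)
    (v : Fin k → ℝ) :
    σ ^ 2 * ∑ s ∈ Finset.Ico 0 t, (∑ l, lagCoeff b t s l * v l) ^ 2 ≤ ‖lagComb X t' v‖ ^ 2 := by
  rw [h.norm_lagComb t' ((t : ℤ) - 1)]
  set c : ℕ → ℝ := fun s => ∑ l, lagCoeff b t s l * v l with hc
  have h1 : ∀ s : ℕ, inner ℝ (lagComb X ((t : ℤ) - 1) v) (E s) = σ ^ 2 * c s := fun s => by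
    simp only [lagComb, sum_inner, real_inner_smul_left, h.inner_lag, hc, Finset.mul_sum]
    exact Finset.sum_congr rfl fun l _ => by ring
  have h2 := h.norm_sum_smul_sq (Finset.Ico 0 t) c (f := fun s : ℕ => (s : ℤ)) Nat.cast_injective
  -- The `c s` are the Fourier coefficients with respect to the orthogonal `E s`, so Bessel follows
  -- from nonnegativity of the squared residual.
  have h3 := norm_sub_sq_real (lagComb X ((t : ℤ) - 1) v) (∑ s ∈ Finset.Ico 0 t, c s • E (s : ℤ))
  rw [inner_sum, h2] at h3
  simp only [real_inner_smul_right, h1] at h3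
  have h4 : ∑ s ∈ Finset.Ico 0 t, c s * (σ ^ 2 * c s) = σ ^ 2 * ∑ s ∈ Finset.Ico 0 t, c s ^ 2 := by
    rw [Finset.mul_sum]
    exact Finset.sum_congr rfl fun s _ => by ring
  rw [h4] at h3
  have h5 := sq_nonneg ‖lagComb X ((t : ℤ) - 1) v - ∑ s ∈ Finset.Ico 0 t, c s • E (s : ℤ)‖
  linarith

/-- Parseval: the norm does not change if the innovations are reindexed by `s ↦ s - (t - 1)`. The
truncated expansions then share the fixed time `0` and are partial sums of convergent series. -/
lemma tendsto_sum_lagCoeff_sq (h : IsLinearProcess a b σ X E) (t' : ℤ) (v : Fin k → ℝ) :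
    Tendsto (fun t : ℕ => σ ^ 2 * ∑ s ∈ Finset.Ico 0 t, (∑ l, lagCoeff b t s l * v l) ^ 2) atTop
      (nhds (‖lagComb X t' v‖ ^ 2)) := by
  rw [h.norm_lagComb t' 0]
  have h1 : ∀ t : ℕ, σ ^ 2 * ∑ s ∈ Finset.Ico 0 t, (∑ l, lagCoeff b t s l * v l) ^ 2
      = ‖∑ l : Fin k, v l • ∑ m ∈ Finset.range (t - l), b m • E (0 - (l : ℕ) - m)‖ ^ 2 := fun t => by
    rw [← h.norm_sum_smul_sq (Finset.Ico 0 t) (fun s => ∑ l, lagCoeff b t s l * v l)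
      (f := fun s : ℕ => (s : ℤ) - (t - 1)) fun i j hij => by simpa using hij]
    congr 2
    simp only [Finset.sum_smul]
    rw [Finset.sum_comm]
    refine Finset.sum_congr rfl fun l _ => ?_
    have e1 := sum_lagCoeff_smul b t l (fun s : ℕ => E ((s : ℤ) - (t - 1)))
    have e2 : ∑ m ∈ Finset.range (t - l), b m • E (0 - ((l : ℕ) : ℤ) - m)
        = ∑ m ∈ Finset.range (t - l), b m • E (((t - 1 - l - m : ℕ) : ℤ) - (t - 1)) := by
      refine Finset.sum_congr rfl fun m hm => ?_
      rw [Finset.mem_range] at hm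
      congr 2
      omega
    rw [e2, ← e1, Finset.smul_sum]
    refine Finset.sum_congr rfl fun s _ => ?_
    rw [smul_smul, mul_comm]
  simp only [h1]
  refine Tendsto.pow (Tendsto.norm ?_) 2
  refine tendsto_finsetSum _ fun l _ => Tendsto.const_smul ?_ _
  exact (h.ma (0 - ((l : ℕ) : ℤ))).tendsto_sum_nat.comp (tendsto_sub_atTop_nat _)

end IsLinearProcess

end LinearProcess

/-! ### Whitening by a factor of `R⁻¹`. -/

section Whitening

open Matrix
open scoped MatrixOrder Matrix.Norms.L2Operator

variable {k : ℕ}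

lemma isUnit_and_exists_whitening {R : Matrix (Fin k) (Fin k) ℝ} (hR : R.IsHermitian) {Λ : ℝ}
    (hΛ : ∀ v : Fin k → ℝ, ∑ l, v l ^ 2 ≤ Λ * (v ⬝ᵥ R *ᵥ v)) (hΛ0 : 0 ≤ Λ) :
    IsUnit R ∧ ∃ T : Matrix (Fin k) (Fin k) ℝ, R⁻¹ = Tᵀ * T ∧ T * R * Tᵀ = 1 := by
  have hpos : R.PosDef := by
    refine Matrix.PosDef.of_dotProduct_mulVec_pos hR fun v hv => ?_
    have h1 : 0 < ∑ l, v l ^ 2 := by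
      obtain ⟨i, hi⟩ := Function.ne_iff.1 hv
      exact Finset.sum_pos' (fun _ _ => sq_nonneg _) ⟨i, Finset.mem_univ i, by
        have : v i ≠ 0 := hi
        positivity⟩
    have h2 := hΛ v
    rw [star_trivial]
    by_contra! h3
    nlinarith [mul_nonneg hΛ0 (neg_nonneg.2 h3)]
  have hunit : IsUnit R := hpos.isUnit
  refine ⟨hunit, ?_⟩
  obtain ⟨T, hT⟩ := CStarAlgebra.nonneg_iff_eq_star_mul_self.1 hpos.inv.posSemidef.nonneg
  rw [Matrix.star_eq_conjTranspose] at hT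
  rw [Matrix.conjTranspose_eq_transpose_of_trivial] at hT
  refine ⟨T, hT, ?_⟩
  have hdet : IsUnit R.det := (Matrix.isUnit_iff_isUnit_det R).1 hunit
  have h1 : (Tᵀ * T) * R = 1 := by rw [← hT]; exact Matrix.nonsing_inv_mul R hdet
  have h2 : (T * R) * Tᵀ = 1 := by
    rw [Matrix.mul_assoc] at h1
    exact mul_eq_one_comm.1 h1
  exact h2

lemma quadForm_transpose_mul_self (T : Matrix (Fin k) (Fin k) ℝ) (y : Fin k → ℝ) :
    quadForm (Tᵀ * T) y = ∑ l, (∑ i, T l i * y i) ^ 2 := by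
  rw [quadForm, ← Matrix.mulVec_mulVec, Matrix.dotProduct_mulVec, Matrix.vecMul_transpose]
  simp [dotProduct, Matrix.mulVec, sq]

lemma dotProduct_mulVec_transpose {T R : Matrix (Fin k) (Fin k) ℝ} (h : T * R * Tᵀ = 1)
    (v : Fin k → ℝ) : (Tᵀ *ᵥ v) ⬝ᵥ R *ᵥ (Tᵀ *ᵥ v) = ∑ l, v l ^ 2 := by
  rw [Matrix.mulVec_transpose, ← Matrix.dotProduct_mulVec, ← Matrix.mulVec_transpose,
    Matrix.mulVec_mulVec, Matrix.mulVec_mulVec, h, Matrix.one_mulVec]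
  simp [dotProduct, sq]

/-- For `z = T y` one has `|z|² = y · Tᵀ z`. Cauchy–Schwarz together with `|Tᵀ z|² ≤ Λ (Tᵀ z)' R (Tᵀ
z) = Λ |z|²` gives the claim. -/
lemma sum_mulVec_sq_le {T R : Matrix (Fin k) (Fin k) ℝ} (h : T * R * Tᵀ = 1) {Λ : ℝ}
    (hΛ : ∀ v : Fin k → ℝ, ∑ l, v l ^ 2 ≤ Λ * (v ⬝ᵥ R *ᵥ v)) (hΛ0 : 0 ≤ Λ) (y : Fin k → ℝ) :
    ∑ l, (∑ i, T l i * y i) ^ 2 ≤ Λ * ∑ i, y i ^ 2 := by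
  set z : Fin k → ℝ := T *ᵥ y with hz
  have h1 : ∑ l, (∑ i, T l i * y i) ^ 2 = ∑ l, z l ^ 2 := rfl
  have h2 : ∑ l, z l ^ 2 = ∑ i, y i * (Tᵀ *ᵥ z) i := by
    have : z ⬝ᵥ T *ᵥ y = y ⬝ᵥ Tᵀ *ᵥ z := by
      rw [Matrix.dotProduct_mulVec, Matrix.mulVec_transpose, dotProduct_comm]
    simpa [← hz, dotProduct, sq] using this
  have h3 := hΛ (Tᵀ *ᵥ z)
  rw [dotProduct_mulVec_transpose h] at h3
  have h4 := Finset.sum_mul_sq_le_sq_mul_sq Finset.univ y (Tᵀ *ᵥ z)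
  rw [← h2] at h4
  rw [h1]
  have hz0 : 0 ≤ ∑ l, z l ^ 2 := Finset.sum_nonneg fun _ _ => sq_nonneg _
  have hy0 : 0 ≤ ∑ i, y i ^ 2 := Finset.sum_nonneg fun _ _ => sq_nonneg _
  rcases hz0.eq_or_lt with h0 | hpos
  · rw [← h0]; positivity
  · have h8 : (∑ l, z l ^ 2) * (∑ l, z l ^ 2) ≤ (Λ * ∑ i, y i ^ 2) * ∑ l, z l ^ 2 := by
      nlinarith [mul_le_mul_of_nonneg_left h3 hy0]
    exact le_of_mul_le_mul_right h8 hpos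

end Whitening

/-! ### The noise as a sequence of innovations. -/

section Noise

/-- The `σ`-algebra generated by the variables with index less than `t`. -/
@[reducible] def strictPast {Ω : Type*} (e : ℕ → Ω → ℝ) (t : ℕ) : MeasurableSpace Ω :=
  ⨆ s ∈ {s : ℕ | s < t}, MeasurableSpace.comap (e s) inferInstance

lemma strictPast_mono {Ω : Type*} (e : ℕ → Ω → ℝ) : Monotone (strictPast e) := fun _ _ h =>
  biSup_mono fun _ hs => lt_of_lt_of_le hs h

variable {Ω : Type*} [mΩ : MeasurableSpace Ω] {μ : Measure Ω}

lemma strictPast_le {e : ℕ → Ω → ℝ} (he : ∀ t, Measurable (e t)) (t : ℕ) : strictPast e t ≤ mΩ :=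
  iSup₂_le fun s _ => (he s).comap_le

lemma measurable_strictPast {Ω : Type*} {e : ℕ → Ω → ℝ} (t : ℕ) : Measurable[strictPast e (t + 1)] (e t) := by
  refine Measurable.mono (comap_measurable (e t)) ?_ le_rfl
  exact le_iSup₂ (f := fun (s : ℕ) (_ : s ∈ {s : ℕ | s < t + 1}) =>
    MeasurableSpace.comap (e s) inferInstance) t (Nat.lt_succ_self t)

lemma indep_strictPast {e : ℕ → Ω → ℝ} (he : ∀ t, Measurable (e t)) (hind : iIndepFun e μ) (t : ℕ) :
    Indep (MeasurableSpace.comap (e t) inferInstance) (strictPast e t) μ := by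
  have h := indep_iSup_of_disjoint (m := fun s => MeasurableSpace.comap (e s) inferInstance)
    (fun s => (he s).comap_le) hind (S := {t}) (T := {s | s < t}) (by simp)
  rwa [iSup_singleton] at h

lemma isInnovation_comp {e : ℕ → Ω → ℝ} (he : ∀ t, Measurable (e t)) (hind : iIndepFun e μ)
    {p : ℝ} {φ : ℝ → ℝ} (hφ : Measurable φ) (hmean : ∀ t, ∫ ω, φ (e t ω) ∂μ = 0)
    (hp : ∀ t, MemLp (fun ω => φ (e t ω)) (ENNReal.ofReal p) μ) :
    IsInnovation μ (strictPast e) p (fun t ω => φ (e t ω)) where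
  mono := strictPast_mono e
  le := strictPast_le he
  measurable t := hφ.comp (measurable_strictPast t)
  indep t := indep_of_indep_of_le_left (indep_strictPast he hind t) (by
    rw [show (fun ω => φ (e t ω)) = φ ∘ e t from rfl, ← MeasurableSpace.comap_comp]
    exact MeasurableSpace.comap_mono hφ.comap_le)
  mean := hmean
  memLp := hp

variable {e : ℤ → Ω → ℝ} {σ q : ℝ}

lemma IsNoise.integral_sq (he : IsNoise μ e σ) (t : ℤ) : ∫ ω, e t ω ^ 2 ∂μ = σ ^ 2 := by
  rw [← he.var t, variance_of_integral_eq_zero (he.measurable t).aemeasurable (he.mean t)]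

lemma exists_lpNorm_le (he : IsNoise μ e σ) (hq : 2 ≤ q)
    (hmom : (⨆ t : ℤ, ∫⁻ ω, ENNReal.ofReal (|e t ω| ^ (2 * q)) ∂μ) < ⊤) :
    ∃ L, ∀ t, MemLp (e t) (ENNReal.ofReal (2 * q)) μ ∧
      lpNorm (e t) (ENNReal.ofReal (2 * q)) μ ≤ L := by
  have hq0 : 0 < 2 * q := by linarith
  set S := ⨆ t : ℤ, ∫⁻ ω, ENNReal.ofReal (|e t ω| ^ (2 * q)) ∂μ with hS
  refine ⟨(S.toReal) ^ (2 * q)⁻¹, fun t => ?_⟩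
  have hle : ∫⁻ ω, ENNReal.ofReal (|e t ω| ^ (2 * q)) ∂μ ≤ S := le_iSup
    (fun t : ℤ => ∫⁻ ω, ENNReal.ofReal (|e t ω| ^ (2 * q)) ∂μ) t
  have hm := he.measurable t
  have hint : Integrable (fun ω => |e t ω| ^ (2 * q)) μ := by
    refine ⟨(hm.abs.pow_const (2 * q)).aestronglyMeasurable, ?_⟩
    rw [hasFiniteIntegral_iff_ofReal (ae_of_all _ fun _ => by positivity)]
    exact hle.trans_lt hmom
  have hmem := (integrable_abs_rpow_iff hq0 hm.aestronglyMeasurable).1 hint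
  refine ⟨hmem, ?_⟩
  rw [Real.le_rpow_inv_iff_of_pos lpNorm_nonneg ENNReal.toReal_nonneg hq0,
    lpNorm_rpow_eq_integral hq0 hmem.1,
    integral_eq_lintegral_of_nonneg_ae (ae_of_all _ fun _ => by positivity) hint.1]
  exact ENNReal.toReal_mono hmom.ne hle

variable [IsProbabilityMeasure μ]

lemma exists_isSquareInnovation (he : IsNoise μ e σ) (hq : 2 ≤ q)
    (hmom : (⨆ t : ℤ, ∫⁻ ω, ENNReal.ofReal (|e t ω| ^ (2 * q)) ∂μ) < ⊤) :
    ∃ L, ∀ M : ℕ, IsSquareInnovation μ (strictPast fun s ω => e ((s : ℤ) - M) ω) q (σ ^ 2) L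
      (fun s ω => e ((s : ℤ) - M) ω) := by
  obtain ⟨L₀, hL₀⟩ := exists_lpNorm_le he hq hmom
  have hq0 : 0 < q := by linarith
  have hmem : ∀ t, MemLp (e t) (ENNReal.ofReal q) μ := fun t =>
    (hL₀ t).1.mono_exponent (ENNReal.ofReal_le_ofReal (by linarith))
  have hsq : ∀ t, MemLp (fun ω => e t ω ^ 2) (ENNReal.ofReal q) μ := fun t => by
    simpa only [sq] using memLp_mul_of_two_mul hq0 (hL₀ t).1 (hL₀ t).1
  have hL0 : 0 ≤ L₀ := lpNorm_nonneg.trans (hL₀ 0).2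
  -- One constant dominates the norms of `e` and of `e² - σ²`, uniformly in the truncation point
  -- `-M`.
  refine ⟨L₀ + (L₀ ^ 2 + σ ^ 2), fun M => ?_⟩
  have hmeas : ∀ s : ℕ, Measurable (fun ω => e ((s : ℤ) - M) ω) := fun s => he.measurable _
  have hind : iIndepFun (fun (s : ℕ) ω => e ((s : ℤ) - M) ω) μ :=
    he.indep.precomp (g := fun s : ℕ => (s : ℤ) - M) fun i j h => by simpa using h
  refine
    { two_le := hq
      nonneg := sq_nonneg σ
      inn := isInnovation_comp hmeas hind measurable_id (fun t => he.mean _) fun t => hmem _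
      inn_two := isInnovation_comp hmeas hind measurable_id (fun t => he.mean _) fun t => (hL₀ _).1
      inn_sq := isInnovation_comp hmeas hind (φ := fun y => y ^ 2 - σ ^ 2) (by fun_prop)
        (fun t => ?_) fun t => (hsq _).sub (memLp_const _)
      norm_le := fun t => ?_
      norm_two_le := fun t => (hL₀ _).2.trans (by nlinarith [sq_nonneg L₀, sq_nonneg σ])
      norm_sq_le := fun t => ?_ }
  · rw [integral_sub (he.memLp _).integrable_sq (integrable_const _), he.integral_sq]
    simp
  · have h1 : lpNorm (e ((t : ℤ) - M)) (ENNReal.ofReal q) μ ≤ L₀ := by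
      refine le_trans ?_ (hL₀ ((t : ℤ) - M)).2
      rw [← toReal_eLpNorm (hmem _).1, ← toReal_eLpNorm (hmem _).1]
      exact ENNReal.toReal_mono (hL₀ _).1.eLpNorm_ne_top
        (eLpNorm_le_eLpNorm_of_exponent_le (ENNReal.ofReal_le_ofReal (by linarith)) (hmem _).1)
    exact h1.trans (by nlinarith [sq_nonneg L₀, sq_nonneg σ])
  · have h1 : lpNorm (fun ω => e ((t : ℤ) - M) ω ^ 2) (ENNReal.ofReal q) μ ≤ L₀ ^ 2 := by
      simp only [sq]
      refine (lpNorm_mul_le_of_two_mul hq0 (hL₀ _).1 (hL₀ _).1).trans ?_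
      exact mul_le_mul (hL₀ _).2 (hL₀ _).2 lpNorm_nonneg hL0
    have h2 := lpNorm_fun_add_le hq (hsq ((t : ℤ) - M)) (g := fun _ => -σ ^ 2)
    rw [lpNorm_const_real hq0, abs_neg, abs_of_nonneg (sq_nonneg σ)] at h2
    simp only [← sub_eq_add_neg] at h2
    linarith

end Noise

/-! ### The process as a curve in `L²`. -/

section Autoregression

variable {Ω : Type*} [MeasurableSpace Ω] {μ : Measure Ω}
  {a : ℕ → ℝ} {x e : ℤ → Ω → ℝ} {σ : ℝ}

lemma inner_toLp_eq_integral {f g : Ω → ℝ} (hf : MemLp f 2 μ) (hg : MemLp g 2 μ) :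
    inner ℝ (hf.toLp f) (hg.toLp g) = ∫ ω, f ω * g ω ∂μ := by
  rw [L2.inner_def]
  refine integral_congr_ae ?_
  filter_upwards [hf.coeFn_toLp, hg.coeFn_toLp] with ω h1 h2
  rw [h1, h2]
  simp [mul_comm]

lemma lpNorm_eq_norm_toLp {f : Ω → ℝ} (hf : MemLp f 2 μ) : lpNorm f 2 μ = ‖hf.toLp f‖ := by
  rw [Lp.norm_toLp, toReal_eLpNorm hf.1]

lemma isHermitian_covMatrix (x : ℤ → Ω → ℝ) (t : ℤ) (k : ℕ) : (covMatrix μ x t k).IsHermitian := by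
  ext i j
  simp [covMatrix, mul_comm]

open Matrix in
lemma IsWeaklyStationary.dotProduct_covMatrix (hx : IsWeaklyStationary μ x) (t : ℤ) {k : ℕ}
    (v : Fin k → ℝ) : v ⬝ᵥ covMatrix μ x t k *ᵥ v
      = ‖lagComb (fun t => (hx.memLp t).toLp (x t)) t v‖ ^ 2 := by
  rw [← real_inner_self_eq_norm_sq]
  simp only [lagComb, sum_inner, inner_sum, real_inner_smul_left, real_inner_smul_right,
    inner_toLp_eq_integral, dotProduct, Matrix.mulVec, Finset.mul_sum, covMatrix, lagVec,
    Matrix.of_apply]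
  rw [Finset.sum_comm]
  refine Finset.sum_congr rfl fun i _ => Finset.sum_congr rfl fun j _ => ?_
  ring

lemma IsNoise.integral_mul (he : IsNoise μ e σ) (s t : ℤ) :
    ∫ ω, e s ω * e t ω ∂μ = if s = t then σ ^ 2 else 0 := by
  split_ifs with h
  · subst h
    simp only [← sq, he.integral_sq]
  · rw [(he.indep.indepFun h).integral_fun_mul_eq_mul_integral
      (he.measurable s).aestronglyMeasurable (he.measurable t).aestronglyMeasurable, he.mean s,
      zero_mul]

variable [IsProbabilityMeasure μ]

lemma IsWeaklyStationary.integral_mul (hx : IsWeaklyStationary μ x) (s t h : ℤ) :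
    ∫ ω, x (s + h) ω * x (t + h) ω ∂μ = ∫ ω, x s ω * x t ω ∂μ := by
  have h1 := hx.cov (t + h) t (s - t)
  rw [show t + h + (s - t) = s + h by ring, show t + (s - t) = s by ring,
    covariance_eq_sub (hx.memLp _) (hx.memLp _), covariance_eq_sub (hx.memLp _) (hx.memLp _),
    hx.mean (s + h) s, hx.mean (t + h) t] at h1
  simpa using h1

/-- The moving average representation of the autoregressive process, almost surely and in `L²`. -/
lemma IsARProcess.exists_isLinearProcess (hx : IsARProcess μ a x e) (he : IsNoise μ e σ) :
    ∃ a' b : ℕ → ℝ, (Summable fun n : ℕ => ((n : ℝ) + 1) * b n ^ 2) ∧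
      (∀ t, ∀ᵐ ω ∂μ, HasSum (fun m : ℕ => b m * e (t - m) ω) (x t ω)) ∧
      IsLinearProcess a' b σ (fun t => (hx.stationary.memLp t).toLp (x t))
        (fun t => (he.memLp t).toLp (e t)) := by
  obtain ⟨a', b, ha0, hasucc, hsa, hsb, hab⟩ := exists_inverse_arSeries hx.ne_zero hx.summable
  have hsb' : Summable fun n => |b n| := by
    refine Summable.of_nonneg_of_le (fun _ => abs_nonneg _) (fun n => ?_) hsb
    have : (1 : ℝ) ≤ √((n : ℝ) + 1) := by
      rw [Real.one_le_sqrt]; linarith [Nat.cast_nonneg (α := ℝ) n]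
    nlinarith [abs_nonneg (b n)]
  have hstat : ∀ s t h : ℤ, inner ℝ ((hx.stationary.memLp (s + h)).toLp (x (s + h)))
      ((hx.stationary.memLp (t + h)).toLp (x (t + h)))
      = inner ℝ ((hx.stationary.memLp s).toLp (x s)) ((hx.stationary.memLp t).toLp (x t)) :=
    fun s t h => by
      rw [inner_toLp_eq_integral, inner_toLp_eq_integral]
      exact hx.stationary.integral_mul s t h
  have hxK : ∀ t, lpNorm (x t) 2 μ ≤ lpNorm (x 0) 2 μ := fun t => by
    rw [lpNorm_eq_norm_toLp (hx.stationary.memLp t), lpNorm_eq_norm_toLp (hx.stationary.memLp 0)]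
    refine (pow_le_pow_iff_left₀ (norm_nonneg _) (norm_nonneg _) two_ne_zero).1 ?_
    rw [← real_inner_self_eq_norm_sq, ← real_inner_self_eq_norm_sq]
    have := hstat 0 0 t
    simp only [zero_add] at this
    exact this.le
  have horth : ∀ s t, inner ℝ ((he.memLp s).toLp (e s)) ((he.memLp t).toLp (e t))
      = if s = t then σ ^ 2 else 0 := fun s t => by
    rw [inner_toLp_eq_integral, he.integral_mul]
  have heK : ∀ t, lpNorm (e t) 2 μ ≤ |σ| := fun t => by
    rw [lpNorm_eq_norm_toLp (he.memLp t)]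
    refine (pow_le_pow_iff_left₀ (norm_nonneg _) (abs_nonneg _) two_ne_zero).1 ?_
    rw [← real_inner_self_eq_norm_sq, horth, if_pos rfl, sq_abs]
  have hAR : ∀ t : ℤ, ∀ᵐ ω ∂μ, HasSum (fun i : ℕ => a' i * x (t - i) ω) (e t ω) := fun t => by
    filter_upwards [hx.ar t] with ω hω
    have h1 : HasSum (fun i : ℕ => a' (i + 1) * x (t - ((i + 1 : ℕ) : ℤ)) ω) (e t ω - x t ω) := by
      simpa only [hasucc, Nat.cast_add, Nat.cast_one] using hω
    have h2 := (hasSum_nat_add_iff (f := fun i : ℕ => a' i * x (t - i) ω) 1).1 h1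
    simpa [ha0] using h2
  have hMA := ae_hasSum_of_autoregression hsa hsb' hab hx.stationary.memLp hxK hAR
  refine ⟨a', b, summable_mul_sq_of_summable_sqrt_mul hsb, hMA, horth, hstat, fun t => ?_,
    fun t => ?_, hsa⟩
  · exact hasSum_toLp_of_ae_hasSum hsa (fun i => hx.stationary.memLp _) (fun i => hxK _)
      (he.memLp t) (hAR t)
  · exact hasSum_toLp_of_ae_hasSum hsb' (fun i => he.memLp _) (fun i => heK _)
      (hx.stationary.memLp t) (hMA t)

end Autoregression

/-- Once `n ≥ 4c²`, the bound `K n ≤ c √n` forces `K n ≤ n / 2`, so `c² n ≤ 2c² (n - K n)`. The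
finitely many smaller `n` are absorbed by `(n₀ + n₁)²`, because `n - K n ≥ 1`. -/
lemma exists_sq_le_of_isBigO_sqrt {K : ℕ → ℕ}
    (hK : (fun n : ℕ => (K n : ℝ)) =O[atTop] (fun n : ℕ => (n : ℝ) ^ (1 / 2 : ℝ))) :
    ∃ D : ℝ, 0 ≤ D ∧ ∀ n, K n < n → (K n : ℝ) ^ 2 ≤ D * ((n - K n : ℕ) : ℝ) := by
  obtain ⟨c, hc⟩ := hK.bound
  obtain ⟨n₀, hn₀⟩ := eventually_atTop.1 hc
  obtain ⟨n₁, hn₁⟩ := exists_nat_gt (4 * c ^ 2)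
  refine ⟨2 * c ^ 2 + ((n₀ + n₁ : ℕ) : ℝ) ^ 2, by positivity, fun n hn => ?_⟩
  have hsub : ((n - K n : ℕ) : ℝ) = n - K n := Nat.cast_sub hn.le
  have hge : (1 : ℝ) ≤ ((n - K n : ℕ) : ℝ) := by exact_mod_cast (by omega : 1 ≤ n - K n)
  rcases Nat.lt_or_ge n (n₀ + n₁) with h | h
  · have h1 : (K n : ℝ) ≤ ((n₀ + n₁ : ℕ) : ℝ) := by exact_mod_cast (hn.trans h).le
    have h2 : (K n : ℝ) ^ 2 ≤ ((n₀ + n₁ : ℕ) : ℝ) ^ 2 := by gcongr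
    nlinarith [sq_nonneg c, mul_nonneg (sq_nonneg ((n₀ + n₁ : ℕ) : ℝ)) (sub_nonneg.2 hge)]
  · have h1 := hn₀ n (by omega)
    rw [← Real.sqrt_eq_rpow, Real.norm_of_nonneg (Nat.cast_nonneg _),
      Real.norm_of_nonneg (Real.sqrt_nonneg _)] at h1
    have h2 : (K n : ℝ) ^ 2 ≤ c ^ 2 * n := by
      calc (K n : ℝ) ^ 2 ≤ (c * √n) ^ 2 := by gcongr
        _ = c ^ 2 * n := by rw [mul_pow, Real.sq_sqrt (Nat.cast_nonneg n)]
    have hn1 : (n₁ : ℝ) ≤ n := by exact_mod_cast (by omega : n₁ ≤ n)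
    have h3 : 4 * (K n : ℝ) ^ 2 ≤ (n : ℝ) ^ 2 := by nlinarith [Nat.cast_nonneg (α := ℝ) n]
    have h4 : 2 * (K n : ℝ) ≤ n := by
      have := abs_le_of_sq_le_sq' (a := 2 * (K n : ℝ)) (b := n) (by nlinarith) (Nat.cast_nonneg n)
      exact this.2
    rw [hsub] at hge ⊢
    nlinarith [sq_nonneg c, mul_nonneg (sq_nonneg c) (by linarith : (0 : ℝ) ≤ n - 2 * K n),
      mul_nonneg (sq_nonneg ((n₀ + n₁ : ℕ) : ℝ)) (by linarith : (0 : ℝ) ≤ n - K n)]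

/-! ### Coefficients of the whitened lag vector. -/

section Whitened

open Matrix

variable {H : Type*} [NormedAddCommGroup H] [InnerProductSpace ℝ H] {a b : ℕ → ℝ} {σ : ℝ}
  {X E : ℤ → H} {k : ℕ}

/-- The coefficients of the whitened vector of lags. -/
def whitenedCoeff (T : Matrix (Fin k) (Fin k) ℝ) (b : ℕ → ℝ) (t s : ℕ) (l : Fin k) : ℝ :=
  ∑ i, T l i * lagCoeff b t s i

namespace IsLinearProcess

/-- Whitening turns the covariance form into the Euclidean one, so the Bessel constant `1 / σ ^ 2`
is free of `k`. In the tail `T` costs only the factor `Λ`. -/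
lemma isScoreCoeff_whitenedCoeff (h : IsLinearProcess a b σ X E) (hσ : 0 < σ)
    (hb : Summable fun n : ℕ => ((n : ℝ) + 1) * b n ^ 2) {R T : Matrix (Fin k) (Fin k) ℝ}
    (hT : T * R * Tᵀ = 1) {t₀ : ℤ}
    (hR : ∀ v : Fin k → ℝ, v ⬝ᵥ R *ᵥ v = ‖lagComb X t₀ v‖ ^ 2) {Λ : ℝ} (hΛ0 : 0 ≤ Λ)
    (hΛ : ∀ v : Fin k → ℝ, ∑ l, v l ^ 2 ≤ Λ * (v ⬝ᵥ R *ᵥ v)) :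
    IsScoreCoeff (1 / σ ^ 2) (Λ * ∑' n : ℕ, ((n : ℝ) + 1) * b n ^ 2) (whitenedCoeff T b) where
  nonneg := by positivity
  nonneg' := mul_nonneg hΛ0 (tsum_nonneg fun n => by positivity)
  bessel t v := by
    have h1 := h.sq_mul_sum_lagCoeff_sq_le t t₀ (Tᵀ *ᵥ v)
    rw [← hR, dotProduct_mulVec_transpose hT] at h1
    have h2 : ∀ s, ∑ l, whitenedCoeff T b t s l * v l = ∑ i, lagCoeff b t s i * (Tᵀ *ᵥ v) i :=
      fun s => by
        simp only [whitenedCoeff, Matrix.mulVec, dotProduct, Matrix.transpose_apply,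
          Finset.sum_mul, Finset.mul_sum]
        rw [Finset.sum_comm]
        exact Finset.sum_congr rfl fun i _ => Finset.sum_congr rfl fun l _ => by ring
    simp only [h2]
    rw [one_div, inv_mul_eq_div, le_div_iff₀ (by positivity), mul_comm]
    exact h1
  tail t := by
    calc _ ≤ ∑ s ∈ Finset.Ico 0 (t - 2 * k), Λ * ∑ i, lagCoeff b t s i ^ 2 :=
          Finset.sum_le_sum fun s _ => sum_mulVec_sq_le hT hΛ hΛ0 _
      _ ≤ _ := by
          rw [← Finset.mul_sum]
          exact mul_le_mul_of_nonneg_left (sum_lagCoeff_sq_tail_le hb t) hΛ0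

/-- The rows of `T` have unit length in the form `R`, so by Parseval each of the `k` coordinates
contributes `1`. -/
lemma tendsto_sum_whitenedCoeff_sq (h : IsLinearProcess a b σ X E)
    {R T : Matrix (Fin k) (Fin k) ℝ} (hT : T * R * Tᵀ = 1) {t₀ : ℤ}
    (hR : ∀ v : Fin k → ℝ, v ⬝ᵥ R *ᵥ v = ‖lagComb X t₀ v‖ ^ 2) :
    Tendsto (fun t : ℕ => σ ^ 2 * ∑ s ∈ Finset.Ico 0 t, ∑ l, whitenedCoeff T b t s l ^ 2) atTop
      (nhds (k : ℝ)) := by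
  have h1 : ∀ l, ‖lagComb X t₀ (T l)‖ ^ 2 = 1 := fun l => by
    have h2 := congrFun (congrFun hT l) l
    rw [← hR]
    simp only [Matrix.mul_apply, Matrix.transpose_apply, Matrix.one_apply_eq, Finset.sum_mul] at h2
    simp only [dotProduct, Matrix.mulVec, Finset.mul_sum]
    rw [← h2, Finset.sum_comm]
    exact Finset.sum_congr rfl fun i _ => Finset.sum_congr rfl fun j _ => by ring
  have h3 := tendsto_finsetSum Finset.univ fun l _ => h.tendsto_sum_lagCoeff_sq t₀ (T l)
  simp only [h1, Finset.sum_const, Finset.card_univ, Fintype.card_fin, nsmul_eq_mul, mul_one] at h3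
  refine h3.congr fun t => ?_
  rw [← Finset.mul_sum, Finset.sum_comm]
  simp only [whitenedCoeff, mul_comm (lagCoeff _ _ _ _)]

end IsLinearProcess

end Whitened

/-! ### Convergence of the truncated score. -/

section Truncation

variable {Ω : Type*} {x e : ℤ → Ω → ℝ} {b : ℕ → ℝ} {k : ℕ}

/-- Index `s` stands for time `s - M`, and `linProc` at `t` uses only `s < t`. Hence `t = j + (M +
1)` uses the noise up to time `j`, and the factor paired with it in the score is `e (j + 1)`. -/
lemma tendsto_linProc {ω : Ω} (h : ∀ t : ℤ, HasSum (fun m : ℕ => b m * e (t - m) ω) (x t ω))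
    (T : Matrix (Fin k) (Fin k) ℝ) (j : ℕ) (l : Fin k) :
    Tendsto (fun M : ℕ => linProc (fun s ω => e ((s : ℤ) - M) ω) (whitenedCoeff T b)
      (j + (M + 1)) l ω) atTop (nhds (∑ i, T l i * lagVec x j k ω i)) := by
  have h1 : ∀ M : ℕ, linProc (fun s ω => e ((s : ℤ) - M) ω) (whitenedCoeff T b) (j + (M + 1)) l ω
      = ∑ i : Fin k, T l i * ∑ m ∈ Finset.range (j + (M + 1) - i),
        b m * e ((j : ℤ) - (i : ℕ) - m) ω := fun M => by
    simp only [linProc, whitenedCoeff, Finset.mul_sum]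
    rw [Finset.sum_comm]
    refine Finset.sum_congr rfl fun i _ => ?_
    have e1 := sum_lagCoeff_smul b (j + (M + 1)) i (fun s : ℕ => e ((s : ℤ) - M) ω)
    simp only [smul_eq_mul] at e1
    have e2 : ∑ m ∈ Finset.range (j + (M + 1) - i), b m * e ((j : ℤ) - (i : ℕ) - m) ω
        = ∑ m ∈ Finset.range (j + (M + 1) - i),
          b m * e (((j + (M + 1) - 1 - i - m : ℕ) : ℤ) - M) ω := by
      refine Finset.sum_congr rfl fun m hm => ?_
      rw [Finset.mem_range] at hm
      congr 2
      omega
    rw [← Finset.mul_sum, e2, ← e1, Finset.mul_sum]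
    exact Finset.sum_congr rfl fun s _ => by ring
  simp only [h1]
  refine tendsto_finsetSum _ fun i _ => Tendsto.const_mul _ ?_
  refine (h _).tendsto_sum_nat.comp ?_
  exact (tendsto_sub_atTop_nat _).comp
    ((tendsto_add_atTop_nat (j + 1)).congr fun M => by omega)

lemma tendsto_partialScore {ω : Ω} (h : ∀ t : ℤ, HasSum (fun m : ℕ => b m * e (t - m) ω) (x t ω))
    (T : Matrix (Fin k) (Fin k) ℝ) (m n : ℕ) (l : Fin k) :
    Tendsto (fun M : ℕ => partialScore (fun s ω => e ((s : ℤ) - M) ω) (whitenedCoeff T b)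
      (m + (M + 1)) (n + (M + 1)) l ω) atTop
      (nhds (∑ j ∈ Finset.Ico m n, e ((j : ℤ) + 1) ω * ∑ i, T l i * lagVec x j k ω i)) := by
  have h1 : ∀ M : ℕ, partialScore (fun s ω => e ((s : ℤ) - M) ω) (whitenedCoeff T b)
      (m + (M + 1)) (n + (M + 1)) l ω = ∑ j ∈ Finset.Ico m n, e ((j : ℤ) + 1) ω *
        linProc (fun s ω => e ((s : ℤ) - M) ω) (whitenedCoeff T b) (j + (M + 1)) l ω := fun M => by
    rw [partialScore, ← Finset.sum_Ico_add']
    refine Finset.sum_congr rfl fun j _ => ?_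
    congr 2
    push_cast
    ring
  simp only [h1]
  exact tendsto_finsetSum _ fun j _ => (tendsto_linProc h T j l).const_mul _

open Matrix in
lemma quadForm_normalizedScore {T : Matrix (Fin k) (Fin k) ℝ} {m n : ℕ} (hmn : m < n) (ω : Ω) :
    quadForm (Tᵀ * T) (normalizedScore x e m n k ω)
      = (1 / ((n - m : ℕ) : ℝ)) *
        ∑ l, (∑ j ∈ Finset.Ico m n, e ((j : ℤ) + 1) ω * ∑ i, T l i * lagVec x j k ω i) ^ 2 := by
  have hN : (0 : ℝ) ≤ (n : ℝ) - m := sub_nonneg.2 (by exact_mod_cast hmn.le)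
  rw [quadForm_transpose_mul_self, Nat.cast_sub hmn.le, Finset.mul_sum]
  refine Finset.sum_congr rfl fun l _ => ?_
  have h1 : ∑ i, T l i * normalizedScore x e m n k ω i
      = 1 / √((n : ℝ) - m) *
        ∑ j ∈ Finset.Ico m n, e ((j : ℤ) + 1) ω * ∑ i, T l i * lagVec x j k ω i := by
    simp only [normalizedScore, Pi.smul_apply, Finset.sum_apply, smul_eq_mul, Finset.mul_sum]
    rw [Finset.sum_comm]
    exact Finset.sum_congr rfl fun j _ => Finset.sum_congr rfl fun i _ => by ring
  rw [h1, mul_pow, div_pow, one_pow, Real.sq_sqrt hN]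

end Truncation

/-! ### Removal of the truncation and conclusion. -/

section Limit

variable {Ω : Type*} [MeasurableSpace Ω] {μ : Measure Ω} [IsProbabilityMeasure μ]
  {a b : ℕ → ℝ} {x e : ℤ → Ω → ℝ} {σ q L D' Λ : ℝ} {k : ℕ}

open Matrix in
/-- Moment bound for the squared whitened score, obtained by truncating the noise in the remote
past. -/
lemma eLpNorm_whitenedScore_le {H : Type*} [NormedAddCommGroup H] [InnerProductSpace ℝ H]
    {X E : ℤ → H} (h : IsLinearProcess a b σ X E) (hσ : 0 < σ)
    (hb : Summable fun n : ℕ => ((n : ℝ) + 1) * b n ^ 2)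
    (hMA : ∀ t : ℤ, ∀ᵐ ω ∂μ, HasSum (fun m : ℕ => b m * e (t - m) ω) (x t ω))
    (he : ∀ M : ℕ, IsSquareInnovation μ (strictPast fun s ω => e ((s : ℤ) - M) ω) q (σ ^ 2) L
      (fun s ω => e ((s : ℤ) - M) ω))
    {R T : Matrix (Fin k) (Fin k) ℝ} (hT : T * R * Tᵀ = 1) {t₀ : ℤ}
    (hR : ∀ v : Fin k → ℝ, v ⬝ᵥ R *ᵥ v = ‖lagComb X t₀ v‖ ^ 2) (hΛ0 : 0 ≤ Λ)
    (hΛ : ∀ v : Fin k → ℝ, ∑ l, v l ^ 2 ≤ Λ * (v ⬝ᵥ R *ᵥ v)) (hD' : 0 ≤ D') {m n N : ℕ}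
    (hmn : n = m + N) (hk1 : 1 ≤ k) (hk : (k : ℝ) ^ 2 ≤ D' * N) :
    eLpNorm (fun ω => ∑ l, (∑ j ∈ Finset.Ico m n, e ((j : ℤ) + 1) ω *
        ∑ i, T l i * lagVec x j k ω i) ^ 2 - σ ^ 2 * (N * k)) (ENNReal.ofReal q) μ
      ≤ ENNReal.ofReal (IsSquareInnovation.scoreConst (type2Const q * L ^ 2)
        (type2Const (2 * q) * L ^ 2) (σ ^ 2) (1 / σ ^ 2)
        (Λ * ∑' n : ℕ, ((n : ℝ) + 1) * b n ^ 2) D' * (N * √k)) := by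
  have hc := h.isScoreCoeff_whitenedCoeff hσ hb hT hR hΛ0 hΛ
  set c := whitenedCoeff T b with hcdef
  set V : ℕ → Fin k → Ω → ℝ := fun M =>
    partialScore (fun s ω => e ((s : ℤ) - M) ω) c (m + (M + 1)) (n + (M + 1)) with hV
  set cen : ℕ → ℝ := fun M => σ ^ 2 * ∑ t ∈ Finset.Ico (m + (M + 1)) (n + (M + 1)),
    σ ^ 2 * ∑ i ∈ Finset.Ico 0 t, ∑ l, c t i l ^ 2 with hcen
  have hVp : ∀ M l, MemLp (V M l) (ENNReal.ofReal (2 * q)) μ := fun M l =>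
    (he M).memLp_partialScore _ _ l
  have hFp : ∀ M, MemLp (fun ω => ∑ l, V M l ω ^ 2 - cen M) (ENNReal.ofReal q) μ := fun M => by
    have h1 := memLp_sum_mul (he M).two_le (hVp M) (hVp M)
    simp only [← sq] at h1
    exact h1.sub (memLp_const _)
  have hcen_lim : Tendsto cen atTop (nhds (σ ^ 2 * (N * k))) := by
    have h1 : ∀ M, cen M = σ ^ 2 * ∑ j ∈ Finset.Ico m n,
        σ ^ 2 * ∑ i ∈ Finset.Ico 0 (j + (M + 1)), ∑ l, c (j + (M + 1)) i l ^ 2 := fun M => by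
      simp only [hcen]
      rw [← Finset.sum_Ico_add' (fun t => σ ^ 2 * ∑ i ∈ Finset.Ico 0 t, ∑ l, c t i l ^ 2)]
    simp only [funext h1]
    have h2 := tendsto_finsetSum (Finset.Ico m n) fun j _ =>
      (h.tendsto_sum_whitenedCoeff_sq hT hR).comp
        ((tendsto_add_atTop_nat (j + 1)).congr fun M => (by omega : M + (j + 1) = j + (M + 1)))
    rw [Finset.sum_const, Nat.card_Ico, nsmul_eq_mul, hmn, Nat.add_sub_cancel_left] at h2
    rw [hmn]
    exact h2.const_mul _
  have hlim : ∀ᵐ ω ∂μ, Tendsto (fun M => ∑ l, V M l ω ^ 2 - cen M) atTop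
      (nhds (∑ l, (∑ j ∈ Finset.Ico m n, e ((j : ℤ) + 1) ω *
        ∑ i, T l i * lagVec x j k ω i) ^ 2 - σ ^ 2 * (N * k))) := by
    filter_upwards [ae_all_iff.2 hMA] with ω hω
    exact (tendsto_finsetSum _ fun l _ => (tendsto_partialScore hω T m n l).pow 2).sub hcen_lim
  -- Fatou's lemma: almost sure convergence suffices because the truncated bounds do not depend on
  -- `M`.
  refine (Lp.eLpNorm_lim_le_liminf_eLpNorm (fun M => (hFp M).1) _ hlim).trans ?_
  refine liminf_le_of_frequently_le' (Frequently.of_forall fun M => ?_)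
  rw [← ofReal_lpNorm (hFp M)]
  exact ENNReal.ofReal_le_ofReal ((he M).lpNorm_score_le hc hD' (by omega) hk1 hk)

end Limit

theorem lemma3 {Ω : Type*} [MeasurableSpace Ω] (μ : Measure Ω) [IsProbabilityMeasure μ]
    (a : ℕ → ℝ) (x e : ℤ → Ω → ℝ) (σ : ℝ) (hσ : 0 < σ)
    (he : IsNoise μ e σ) (hx : IsARProcess μ a x e)
    (q : ℝ) (hq : 2 ≤ q)
    (hmom : (⨆ t : ℤ, ∫⁻ ω, ENNReal.ofReal (|e t ω| ^ (2 * q)) ∂μ) < (⊤ : ENNReal))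
    (K : ℕ → ℕ)
    (hK : (fun n : ℕ => (K n : ℝ)) =O[atTop] (fun n : ℕ => (n : ℝ) ^ (1 / 2 : ℝ))) :
    ∃ C : ℝ, ∀ n : ℕ, K n < n → ∀ k : ℕ, 1 ≤ k → k ≤ K n →
      IsUnit (covMatrix μ x n k) ∧
      Integrable (fun ω =>
        |quadForm (covMatrix μ x n k)⁻¹ (normalizedScore x e (K n) n k ω)
          - (k : ℝ) * σ ^ 2| ^ q) μ ∧
      (k : ℝ) ^ (-q / 2) * (∫ ω,
        |quadForm (covMatrix μ x n k)⁻¹ (normalizedScore x e (K n) n k ω)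
          - (k : ℝ) * σ ^ 2| ^ q ∂μ) ≤ C := by
  have hq0 : 0 < q := by linarith
  obtain ⟨a', b, hb, hMA, hlin⟩ := hx.exists_isLinearProcess he
  obtain ⟨L, hL⟩ := exists_isSquareInnovation he hq hmom
  obtain ⟨D', hD', hKD⟩ := exists_sq_le_of_isBigO_sqrt hK
  set Λ : ℝ := (∑' i, |a' i|) ^ 2 / σ ^ 2 with hΛdef
  have hΛ0 : 0 ≤ Λ := by positivity
  set C₀ := IsSquareInnovation.scoreConst (type2Const q * L ^ 2)
        (type2Const (2 * q) * L ^ 2) (σ ^ 2) (1 / σ ^ 2)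
        (Λ * ∑' n : ℕ, ((n : ℝ) + 1) * b n ^ 2) D' with hC₀
  -- The maximum with `0` provides a nonnegative base for the real power without a separate sign
  -- check on `C₀`.
  refine ⟨(max C₀ 0) ^ q, fun n hn k hk1 hkK => ?_⟩
  have hR := fun v : Fin k → ℝ => hx.stationary.dotProduct_covMatrix (n : ℤ) v
  have hΛ : ∀ v : Fin k → ℝ,
      ∑ l, v l ^ 2 ≤ Λ * dotProduct v ((covMatrix μ x n k).mulVec v) := fun v => by
    rw [hR, hΛdef, div_mul_eq_mul_div, le_div_iff₀ (by positivity), mul_comm]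
    exact hlin.sq_mul_sum_sq_le n v
  obtain ⟨hunit, T, hinv, hT⟩ :=
    isUnit_and_exists_whitening (isHermitian_covMatrix x n k) hΛ hΛ0
  refine ⟨hunit, ?_⟩
  have hNpos : (0 : ℝ) < ((n - K n : ℕ) : ℝ) := by exact_mod_cast (by omega : 0 < n - K n)
  have hkpos : (0 : ℝ) < k := by exact_mod_cast hk1
  have hkD : (k : ℝ) ^ 2 ≤ D' * ((n - K n : ℕ) : ℝ) := by
    refine le_trans ?_ (hKD n hn)
    gcongr
  have hmain := eLpNorm_whitenedScore_le hlin hσ hb hMA hL hT hR hΛ0 hΛ hD'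
    (m := K n) (n := n) (N := n - K n) (by omega) hk1 hkD
  rw [← hC₀] at hmain
  set N : ℕ := n - K n with hN
  set F : Ω → ℝ := fun ω => ∑ l, (∑ j ∈ Finset.Ico (K n) n, e ((j : ℤ) + 1) ω *
    ∑ i, T l i * lagVec x j k ω i) ^ 2 - σ ^ 2 * (N * k) with hF
  have hFm : Measurable F := by
    have h1 := he.measurable
    have h2 := hx.stationary.measurable
    simp only [hF, lagVec]
    fun_prop
  have hFp : MemLp F (ENNReal.ofReal q) μ :=
    ⟨hFm.aestronglyMeasurable, hmain.trans_lt ENNReal.ofReal_lt_top⟩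
  have hG : ∀ ω, quadForm (covMatrix μ x n k)⁻¹ (normalizedScore x e (K n) n k ω)
      - (k : ℝ) * σ ^ 2 = (1 / (N : ℝ)) * F ω := fun ω => by
    rw [hinv, quadForm_normalizedScore hn]
    simp only [hF]
    rw [← hN]
    field_simp
  simp only [hG]
  have hGp : MemLp (fun ω => (1 / (N : ℝ)) * F ω) (ENNReal.ofReal q) μ := hFp.const_mul _
  refine ⟨(integrable_abs_rpow_iff hq0 hGp.1).2 hGp, ?_⟩
  rw [← lpNorm_rpow_eq_integral hq0 hGp.1]
  have hFn : lpNorm F (ENNReal.ofReal q) μ ≤ max C₀ 0 * (N * √k) := by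
    have h1 : ENNReal.ofReal (lpNorm F (ENNReal.ofReal q) μ)
        ≤ ENNReal.ofReal (max C₀ 0 * (N * √k)) := by
      rw [ofReal_lpNorm hFp]
      refine hmain.trans (ENNReal.ofReal_le_ofReal ?_)
      gcongr
      exact le_max_left _ _
    exact (ENNReal.ofReal_le_ofReal_iff
      (mul_nonneg (le_max_right _ _) (by positivity))).1 h1
  have hGn : lpNorm (fun ω => (1 / (N : ℝ)) * F ω) (ENNReal.ofReal q) μ ≤ max C₀ 0 * √k := by
    rw [lpNorm_fun_const_mul, abs_of_pos (by positivity), div_mul_eq_mul_div, one_mul,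
      div_le_iff₀ hNpos]
    linarith
  calc (k : ℝ) ^ (-q / 2) * lpNorm (fun ω => (1 / (N : ℝ)) * F ω) (ENNReal.ofReal q) μ ^ q
      ≤ (k : ℝ) ^ (-q / 2) * (max C₀ 0 * √k) ^ q := by
        gcongr
        exact lpNorm_nonneg
    _ = (max C₀ 0) ^ q := by
        rw [Real.mul_rpow (le_max_right _ _) (Real.sqrt_nonneg _), Real.sqrt_eq_rpow,
          ← Real.rpow_mul hkpos.le, mul_left_comm, ← Real.rpow_add hkpos,
          show -q / 2 + 1 / 2 * q = 0 by ring, Real.rpow_zero, mul_one]
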